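/- A planar convex body is a nonempty compact convex subset of $\mathbb{R}^2$ (its interior may be empty and its boundary need not be smooth); $\mathcal{K}$ is the set of all of them, with the barycentric operation $c_\lambda(K, L) = (1-\lambda)K + \lambda L$ (Minkowski sum), $\lambda \in [0,1]$. A map from $\mathcal{K}$ to a real vector space is convex-linear if it preserves barycentric operations; a functional $f : \mathcal{K} \to \mathbb{R}$ is quadratic if $f(K) = g(K, K)$ for some $g : \mathcal{K} \times \mathcal{K} \to \mathbb{R}$ that is convex-linear in each variable, and convex if $f(c_\lambda(K, L)) \le (1-\lambda) f(K) + \lambda f(L)$ always. Let $u_t = (\cos t, \sin t)$, $v_t = (-\sin t, \cos t)$. For $K \in \mathcal{K}$ let $h_K(t) = \sup_{p \in K} p \cdot u_t$, let $l_K(t) = \{p : p \cdot u_t = h_K(t)\}$ be the supporting line and $e_K(t) = K \cap l_K(t)$ the edge, and let $v_K^+(t)$, $v_K^-(t)$ be the endpoints of $e_K(t)$ farthest in the directions $v_t$ and $-v_t$ respectively. For $p, q \in \mathbb{R}^2$ write $p \times q = p_1 q_2 - p_2 q_1$ and $\mathcal{J}(p, q) = \frac12\, p \times q$. For $\mathbf{x}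 : [c, d] \to \mathbb{R}^2$ continuous of bounded variation let $\mathcal{J}(\mathbf{x}) = \frac12 \int_c^d \mathbf{x}(t) \times d\mathbf{x}(t)$ (Lebesgue–Stieltjes integral). For a rectifiable oriented Jordan arc $\Gamma$ (one-point arcs are allowed), $\mathcal{J}(\Gamma)$ is the common value of $\mathcal{J}(\mathbf{x})$ over its injective continuous parametrizations of bounded variation with the given starting and ending points. Theorem (generalized Mamikon theorem). Let $a < b < a + \pi$. (0) For every $K \in \mathcal{K}$ the set $$\mathbf{u}_K^{a,b} = \{v_K^+(a)\} \cup \bigcup_{t \in (a,b)} e_K(t) \cup \{v_K^-(b)\}$$ is a rectifiable Jordan arc from $v_K^+(a)$ to $v_K^-(b)$, and $\mathcal{J}(\mathbf{u}_K^{a,b})$ is well-defined, that is, independent of the parametrization. Hence, for $K \in \mathcal{K}$ and any continuous $\mathbf{z} : [a,b] \to \mathbb{R}^2$ of bounded variation with $\mathbf{z}(t) \in l_K(t)$ for all $t \in [a,b]$, one can define the signed area of the region swept by the tangent segments from $v_K^+(t)$ to $\mathbf{z}(t)$, $t \in [a,b]$, by $$\mathcal{M}_K(a, b; \mathbf{z})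 = \mathcal{J}(v_K^+(a), \mathbf{z}(a)) + \mathcal{J}(\mathbf{z}) + \mathcal{J}(\mathbf{z}(b), v_K^-(b)) - \mathcal{J}(\mathbf{u}_K^{a,b}).$$ (1) For all such $K$ and $\mathbf{z}$, the function $\alpha : [a,b] \to \mathbb{R}$, $\alpha(t) = (\mathbf{z}(t) - v_K^+(t)) \cdot v_t$, is bounded and measurable, satisfies $\mathbf{z}(t) = v_K^+(t) + \alpha(t) v_t$ for all $t \in [a,b]$, and $$\mathcal{M}_K(a, b; \mathbf{z}) = \frac12 \int_a^b \alpha(t)^2 \, dt.$$ (2) Suppose that to each $K \in \mathcal{K}$ is assigned a continuous function $\mathbf{z}_K : [a,b] \to \mathbb{R}^2$ of bounded variation such that $\mathbf{z}_K(t) \in l_K(t)$ for all $t \in [a,b]$ and $K \mapsto \mathbf{z}_K$ is convex-linear. Then $K \mapsto \mathcal{M}_K(a, b; \mathbf{z}_K)$ is quadratic and convex on $\mathcal{K}$. -/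

import Mathlib

open Set MeasureTheory

noncomputable section

namespace Mamikon

/-- The Euclidean plane. -/
abbrev Plane : Type := EuclideanSpace ℝ (Fin 2)

/-- Planar convex bodies: nonempty compact convex subsets of the plane (the interior may be
empty). -/
abbrev Body : Type := ConvexBody Plane

/-! ### Convex-linear maps, quadratic and convex functionals on planar convex bodies -/

/-- The barycentric operation `(1 - r) K + r L = {(1 - r) p + r q : p ∈ K, q ∈ L}`. -/
def bary (r : ℝ) (K L : Body) : Body := (1 - r) • K + r • L

/-- A map from planar convex bodies to a real vector space that preserves the barycentric
operations. -/
def IsConvexLinear {V : Type*} [AddCommGroup V] [Module ℝ V] (f : Body → V) : Prop :=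
  ∀ r ∈ Icc (0 : ℝ) 1, ∀ K L : Body, f (bary r K L) = (1 - r) • f K + r • f L

/-- Convex-linear in each of the two variables. -/
def IsConvexBilinear (g : Body → Body → ℝ) : Prop :=
  (∀ K, IsConvexLinear (fun L => g K L)) ∧ (∀ L, IsConvexLinear (fun K => g K L))

/-- A quadratic functional: the diagonal of a convex-bilinear map. -/
def IsQuadratic (f : Body → ℝ) : Prop :=
  ∃ g : Body → Body → ℝ, IsConvexBilinear g ∧ ∀ K, f K = g K K

/-- A convex functional. -/
def IsConvexFunctional (f : Body → ℝ) : Prop :=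
  ∀ r ∈ Icc (0 : ℝ) 1, ∀ K L : Body, f (bary r K L) ≤ (1 - r) * f K + r * f L

/-! ### Support function, supporting lines, edges and vertices -/

/-- `u_t = (cos t, sin t)`. -/
def u (t : ℝ) : Plane := !₂[Real.cos t, Real.sin t]

/-- `v_t = (-sin t, cos t)`. -/
def v (t : ℝ) : Plane := !₂[-Real.sin t, Real.cos t]

/-- The support function `h_K(t) = sup {p · u_t : p ∈ K}`. -/
def supp (K : Body) (t : ℝ) : ℝ := sSup ((fun p : Plane => inner ℝ p (u t)) '' (K : Set Plane))

/-- The supporting line `l_K(t) = {p : p · u_t = h_K(t)}`. -/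
def suppLine (K : Body) (t : ℝ) : Set Plane := {p | inner ℝ p (u t) = supp K t}

/-- The edge `e_K(t) = K ∩ l_K(t)`. -/
def edge (K : Body) (t : ℝ) : Set Plane := (K : Set Plane) ∩ suppLine K t

/-- The vertex `v_K^+(t)`: the endpoint of the edge `e_K(t)` that is farthest in the direction
of `v_t` (see `vPlus_mem_edge` and `inner_le_vPlus`). -/
def vPlus (K : Body) (t : ℝ) : Plane :=
  supp K t • u t + sSup ((fun p : Plane => inner ℝ p (v t)) '' edge K t) • v t

/-- The vertex `v_K^-(t)`: the endpoint of the edge `e_K(t)` that is farthest in the direction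
of `-v_t` (see `vMinus_mem_edge` and `vMinus_le_inner`). -/
def vMinus (K : Body) (t : ℝ) : Plane :=
  supp K t • u t + sInf ((fun p : Plane => inner ℝ p (v t)) '' edge K t) • v t

theorem eq_frame (p : Plane) (t : ℝ) :
    p = (inner ℝ p (u t) : ℝ) • u t + (inner ℝ p (v t) : ℝ) • v t := by
  have h := Real.sin_sq_add_cos_sq t
  ext i
  fin_cases i
  · simp [u, v, PiLp.inner_apply, Fin.sum_univ_two]
    linear_combination (-(p 0)) * h
  · simp [u, v, PiLp.inner_apply, Fin.sum_univ_two]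
    linear_combination (-(p 1)) * h

theorem inner_v_frame (x y t : ℝ) : (inner ℝ (x • u t + y • v t) (v t) : ℝ) = y := by
  have h := Real.sin_sq_add_cos_sq t
  simp [u, v, PiLp.inner_apply, Fin.sum_univ_two]
  linear_combination y * h

theorem edge_nonempty (K : Body) (t : ℝ) : (edge K t).Nonempty := by
  obtain ⟨p, hp, he⟩ := K.isCompact.exists_sSup_image_eq K.nonempty
    (f := fun p : Plane => (inner ℝ p (u t) : ℝ)) (by fun_prop)
  exact ⟨p, hp, he.symm⟩

theorem isCompact_edge (K : Body) (t : ℝ) : IsCompact (edge K t) :=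
  K.isCompact.inter_right (isClosed_eq (by fun_prop) continuous_const)

theorem vPlus_mem_edge (K : Body) (t : ℝ) : vPlus K t ∈ edge K t := by
  obtain ⟨p, hp, he⟩ := (isCompact_edge K t).exists_sSup_image_eq (edge_nonempty K t)
    (f := fun p : Plane => (inner ℝ p (v t) : ℝ)) (by fun_prop)
  have h2 : inner ℝ p (u t) = supp K t := hp.2
  have : vPlus K t = p := by
    rw [vPlus, he, ← h2]
    exact (eq_frame p t).symm
  rwa [this]

theorem inner_le_vPlus (K : Body) (t : ℝ) {p : Plane} (hp : p ∈ edge K t) :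
    (inner ℝ p (v t) : ℝ) ≤ inner ℝ (vPlus K t) (v t) := by
  rw [vPlus, inner_v_frame]
  exact le_csSup ((isCompact_edge K t).image (by fun_prop)).bddAbove (mem_image_of_mem _ hp)

theorem vMinus_mem_edge (K : Body) (t : ℝ) : vMinus K t ∈ edge K t := by
  obtain ⟨p, hp, he⟩ := (isCompact_edge K t).exists_sInf_image_eq (edge_nonempty K t)
    (f := fun p : Plane => (inner ℝ p (v t) : ℝ)) (by fun_prop)
  have h2 : inner ℝ p (u t) = supp K t := hp.2
  have : vMinus K t = p := by
    rw [vMinus, he, ← h2]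
    exact (eq_frame p t).symm
  rwa [this]

theorem vMinus_le_inner (K : Body) (t : ℝ) {p : Plane} (hp : p ∈ edge K t) :
    (inner ℝ (vMinus K t) (v t) : ℝ) ≤ inner ℝ p (v t) := by
  rw [vMinus, inner_v_frame]
  exact csInf_le ((isCompact_edge K t).image (by fun_prop)).bddBelow (mem_image_of_mem _ hp)

/-! ### Lebesgue–Stieltjes integral and the curve area functional -/

/-- Extend a function on `[c, d]` to the real line by its end values. -/
def clampExt (c d : ℝ) (f : ℝ → ℝ) : ℝ → ℝ := fun t => f (max c (min t d))

theorem boundedVariationOn_clampExt {c d : ℝ} (hcd : c ≤ d) {f : ℝ → ℝ}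
    (hf : BoundedVariationOn f (Icc c d)) : BoundedVariationOn (clampExt c d f) univ := by
  refine ne_top_of_le_ne_top hf (eVariationOn.comp_le_of_monotoneOn f (fun t => max c (min t d))
    ?_ ?_)
  · intro x _ y _ hxy
    exact max_le_max le_rfl (min_le_min hxy le_rfl)
  · intro x _
    exact ⟨le_max_left _ _, max_le hcd (min_le_right _ _)⟩

open scoped Classical in
/-- The Lebesgue–Stieltjes measure `df` of a right-continuous function `f` of bounded variation
on `[c, d]`: it has `df({c}) = 0` and `df((c, t]) = f(t) - f(c)`. -/
def stieltjes (c d : ℝ) (f : ℝ → ℝ) : SignedMeasure ℝ :=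
  if h : BoundedVariationOn (clampExt c d f) univ then h.vectorMeasure else 0

/-- The Lebesgue–Stieltjes integral `∫_c^d g df`. -/
def stieltjesIntegral (c d : ℝ) (g f : ℝ → ℝ) : ℝ :=
  ∫ᵛ t in Icc c d, g t ∂•(stieltjes c d f)

/-- The cross product `p × q` of two vectors of the plane. -/
def cross (p q : Plane) : ℝ := p 0 * q 1 - p 1 * q 0

/-- `x` restricted to `[c, d]` is continuous and of bounded variation. -/
def IsCBV (c d : ℝ) (x : ℝ → Plane) : Prop :=
  ContinuousOn x (Icc c d) ∧ BoundedVariationOn x (Icc c d)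

/-- The curve area functional `J(x) = ½ ∫_c^d x × dx` of a curve on `[c, d]`. -/
def curveArea (c d : ℝ) (x : ℝ → Plane) : ℝ :=
  (stieltjesIntegral c d (fun t => x t 0) (fun t => x t 1) -
    stieltjesIntegral c d (fun t => x t 1) (fun t => x t 0)) / 2

/-- The curve area functional `J(p, q) = ½ p × q` of the oriented segment from `p` to `q`. -/
def segArea (p q : Plane) : ℝ := cross p q / 2

/-- `x` on `[c, d]` is a rectifiable parametrization of the oriented Jordan arc `Γ` from `p`
to `q` (`c = d` is allowed: one-point arcs). -/
structure IsArcParam (Γ : Set Plane) (p q : Plane) (c d : ℝ) (x : ℝ → Plane) : Prop where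
  le : c ≤ d
  cbv : IsCBV c d x
  injOn : InjOn x (Icc c d)
  image_eq : x '' Icc c d = Γ
  start_eq : x c = p
  end_eq : x d = q

/-- `Γ` is a rectifiable Jordan arc from `p` to `q`. -/
def IsRectifiableArc (Γ : Set Plane) (p q : Plane) : Prop :=
  ∃ (c d : ℝ) (x : ℝ → Plane), IsArcParam Γ p q c d x

open scoped Classical in
/-- The curve area functional of a rectifiable oriented Jordan arc: the common value of `J(x)`
over its parametrizations `x`. -/
def arcArea (Γ : Set Plane) (p q : Plane) : ℝ :=
  if h : IsRectifiableArc Γ p q then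
    curveArea h.choose h.choose_spec.choose h.choose_spec.choose_spec.choose
  else 0

/-! ### The convex curve and the area of the Mamikon region -/

/-- The boundary segment `u_K^{a,b} = {v_K^+(a)} ∪ ⋃_{t ∈ (a, b)} e_K(t) ∪ {v_K^-(b)}`. -/
def convexCurve (K : Body) (a b : ℝ) : Set Plane :=
  {vPlus K a} ∪ (⋃ t ∈ Ioo a b, edge K t) ∪ {vMinus K b}

/-- The signed area `M_K(a, b; z)` of the Mamikon region bounded by `u_K^{a,b}` and `z`. -/
def mamikonArea (K : Body) (a b : ℝ) (z : ℝ → Plane) : ℝ :=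
  segArea (vPlus K a) (z a) + curveArea a b z + segArea (z b) (vMinus K b)
    - arcArea (convexCurve K a b) (vPlus K a) (vMinus K b)

/-- The signed length `α(t) = (z(t) - v_K^+(t)) · v_t` of the tangent segment. -/
def tangentLength (K : Body) (z : ℝ → Plane) (t : ℝ) : ℝ := inner ℝ (z t - vPlus K t) (v t)

end Mamikon

end

namespace Mamikon

/-! Infinitesimally, a tangent segment of length `α` that turns by `dt` sweeps the area `½ α² dt`,
while motion along the convex curve contributes only to higher order. The proof makes this rigorous
without smoothness by comparing additive functions of intervals: if such a function is bounded on
all short intervals by `ε` times a fixed additive function, for every `ε > 0`, then it vanishes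
(`AdditiveOn.abs_le_of_forall_eps`).

By `IsCBV.exists_additive_area`, the area of a continuous curve of bounded variation is additive in
this sense and close to the area of the chord. Two parametrizations of an oriented arc differ by a
monotone change of parameter and have the same chords, so their areas agree.

Since `b - a < π`, the boundary segment is the graph of a concave Lipschitz function over the
direction `v m`, with `m` the middle of `[a, b]`. This yields its parametrization, and concavity
makes the area between a piece of it and its chord small.

For (1), `[s, t]` is assigned the closed quadrilateral with the vertices of `K` at `s`, `t` and the
points `z s`, `z t`. Its area is `½ α(s) α(t) sin (t - s)` up to an error of order `t - s` times the
advance along the curve. This advance is additive, so all errors are absorbed, even where edges make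
`α` jump (`IsChart.mamikonArea_eq`).

For (2), `v_K^+` is compatible with Minkowski combinations, so `α` is convex-linear in `K` and `½ ∫
α²` is a nonnegative quadratic form in it. -/

/-! ### Additive interval functions -/

/-- A function of intervals contained in `[c, d]` that is additive under concatenation. -/
def AdditiveOn (c d : ℝ) (J : ℝ → ℝ → ℝ) : Prop :=
  ∀ ⦃s m t⦄, c ≤ s → s ≤ m → m ≤ t → t ≤ d → J s t = J s m + J m t

namespace AdditiveOn

variable {c d : ℝ} {J A U V W : ℝ → ℝ → ℝ}

theorem mono (hJ : AdditiveOn c d J) {c' d' : ℝ} (hc : c ≤ c') (hd : d' ≤ d) :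
    AdditiveOn c' d' J := fun _ _ _ h1 h2 h3 h4 => hJ (hc.trans h1) h2 h3 (h4.trans hd)

theorem add (hJ : AdditiveOn c d J) (hA : AdditiveOn c d A) :
    AdditiveOn c d (fun s t => J s t + A s t) := by
  intro s m t h1 h2 h3 h4
  simp only [hJ h1 h2 h3 h4, hA h1 h2 h3 h4]
  ring

theorem const_mul (k : ℝ) (hJ : AdditiveOn c d J) : AdditiveOn c d (fun s t => k * J s t) := by
  intro s m t h1 h2 h3 h4
  simp only [hJ h1 h2 h3 h4]
  ring

theorem sub (hJ : AdditiveOn c d J) (hA : AdditiveOn c d A) :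
    AdditiveOn c d (fun s t => J s t - A s t) := by
  intro s m t h1 h2 h3 h4
  simp only [hJ h1 h2 h3 h4, hA h1 h2 h3 h4]
  ring

theorem increment (f : ℝ → ℝ) : AdditiveOn c d (fun s t => f t - f s) := by
  intro s m t _ _ _ _
  ring

theorem comp (hJ : AdditiveOn c d J) {c' d' : ℝ} {φ : ℝ → ℝ} (hφ : MonotoneOn φ (Icc c' d'))
    (hm : MapsTo φ (Icc c' d') (Icc c d)) : AdditiveOn c' d' (fun s t => J (φ s) (φ t)) := by
  intro s m t h1 h2 h3 h4
  have hs : s ∈ Icc c' d' := ⟨h1, h2.trans (h3.trans h4)⟩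
  have hm' : m ∈ Icc c' d' := ⟨h1.trans h2, h3.trans h4⟩
  have ht : t ∈ Icc c' d' := ⟨h1.trans (h2.trans h3), h4⟩
  exact hJ (hm hs).1 (hφ hs hm' h2) (hφ hm' ht h3) (hm ht).2

/-- A bound that holds on all short intervals holds on all intervals. -/
theorem abs_le_of_short (hA : AdditiveOn c d A) (hU : AdditiveOn c d U) {δ : ℝ} (hδ : 0 < δ)
    (h : ∀ s t, c ≤ s → s ≤ t → t ≤ d → t - s < δ → |A s t| ≤ U s t) (hcd : c ≤ d) :
    |A c d| ≤ U c d := by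
  -- Induction on the number of pieces, cutting off a last piece of length at most `δ / 2`; the half
  -- secures the strict bound `< δ`.
  have key : ∀ n : ℕ, ∀ s t, c ≤ s → s ≤ t → t ≤ d → t - s ≤ n * (δ / 2) →
      |A s t| ≤ U s t := by
    intro n
    induction n with
    | zero =>
      intro s t h1 h2 h3 h4
      exact h s t h1 h2 h3 (by simp at h4; linarith)
    | succ n ih =>
      intro s t h1 h2 h3 h4
      push_cast at h4
      have hm1 : s ≤ max s (t - δ / 2) := le_max_left _ _
      have hm2 : max s (t - δ / 2) ≤ t := max_le h2 (by linarith)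
      have hm3 : t - δ / 2 ≤ max s (t - δ / 2) := le_max_right _ _
      have hm4 : max s (t - δ / 2) - s ≤ n * (δ / 2) := by
        have : 0 ≤ (n : ℝ) * (δ / 2) := by positivity
        rcases max_cases s (t - δ / 2) with ⟨h, -⟩ | ⟨h, -⟩ <;> rw [h] <;> linarith
      rw [hA h1 hm1 hm2 h3, hU h1 hm1 hm2 h3]
      exact (abs_add_le _ _).trans (add_le_add (ih _ _ h1 hm1 (hm2.trans h3) hm4)
        (h _ _ (h1.trans hm1) hm2 h3 (by linarith)))
  obtain ⟨n, hn⟩ := exists_nat_ge ((d - c) / (δ / 2))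
  exact key n c d le_rfl hcd le_rfl ((div_le_iff₀ (by positivity)).1 hn)

/-- A bound that holds on short intervals up to a small multiple of an additive function holds
on all intervals. -/
theorem abs_le_of_forall_eps (hA : AdditiveOn c d A) (hW : AdditiveOn c d W)
    (hV : AdditiveOn c d V)
    (h : ∀ ε > 0, ∃ δ > 0, ∀ s t, c ≤ s → s ≤ t → t ≤ d → t - s < δ →
      |A s t| ≤ W s t + ε * V s t) (hcd : c ≤ d) :
    |A c d| ≤ W c d := by
  refine le_of_forall_pos_le_add fun η hη => ?_
  obtain ⟨δ, hδ, hb⟩ := h (η / (|V c d| + 1)) (by positivity)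
  refine (hA.abs_le_of_short (hW.add (hV.const_mul _)) hδ hb hcd).trans ?_
  gcongr
  calc η / (|V c d| + 1) * V c d ≤ η / (|V c d| + 1) * (|V c d| + 1) := by
        gcongr
        linarith [le_abs_self (V c d)]
    _ = η := by field_simp

end AdditiveOn

/-! ### The curve area functional as an additive interval function -/

theorem clampExt_of_mem {c d t : ℝ} (f : ℝ → ℝ) (ht : t ∈ Icc c d) : clampExt c d f t = f t := by
  simp [clampExt, ht.1, ht.2]

theorem continuous_clampExt {c d : ℝ} (hcd : c ≤ d) {f : ℝ → ℝ} (hf : ContinuousOn f (Icc c d)) :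
    Continuous (clampExt c d f) :=
  hf.comp_continuous (by fun_prop) fun _ => ⟨le_max_left _ _, max_le hcd (min_le_right _ _)⟩

theorem isFiniteMeasure_variation (μ : SignedMeasure ℝ) : IsFiniteMeasure μ.variation := by
  rw [← SignedMeasure.totalVariation_eq_variation, SignedMeasure.totalVariation]
  infer_instance

section Stieltjes

variable {c d : ℝ} {f g : ℝ → ℝ}

/-- Clamping extends `f` continuously to the whole line, so the one-sided limits in the measure of
an interval are values of `f`. -/
theorem stieltjes_Ioc (hcd : c ≤ d) (hf : ContinuousOn f (Icc c d))
    (hb : BoundedVariationOn f (Icc c d)) {s t : ℝ} (hs : c ≤ s) (hst : s ≤ t) (ht : t ≤ d) :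
    stieltjes c d f (Ioc s t) = f t - f s := by
  have hB := boundedVariationOn_clampExt hcd hb
  have hc := continuous_clampExt hcd hf
  rw [stieltjes, dif_pos hB, hB.vectorMeasure_Ioc hst, hc.continuousWithinAt.rightLim_eq,
    hc.continuousWithinAt.rightLim_eq, clampExt_of_mem _ ⟨hs, hst.trans ht⟩,
    clampExt_of_mem _ ⟨hs.trans hst, ht⟩]

theorem stieltjes_singleton (hcd : c ≤ d) (hf : ContinuousOn f (Icc c d))
    (hb : BoundedVariationOn f (Icc c d)) (s : ℝ) : stieltjes c d f {s} = 0 := by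
  have hB := boundedVariationOn_clampExt hcd hb
  have hc := continuous_clampExt hcd hf
  rw [stieltjes, dif_pos hB, hB.vectorMeasure_singleton, hc.continuousWithinAt.rightLim_eq,
    hc.continuousWithinAt.leftLim_eq, sub_self]

theorem abs_increment_le_variation (hcd : c ≤ d) (hf : ContinuousOn f (Icc c d))
    (hb : BoundedVariationOn f (Icc c d)) {s t : ℝ} (hs : c ≤ s) (hst : s ≤ t) (ht : t ≤ d) :
    |f t - f s| ≤ (stieltjes c d f).variation.real (Ioc s t) := by
  have := isFiniteMeasure_variation (stieltjes c d f)
  rw [← stieltjes_Ioc hcd hf hb hs hst ht, ← Real.norm_eq_abs]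
  exact VectorMeasure.norm_measure_le_variation (hE := measure_ne_top _ _)

theorem additiveOn_variation (μ : SignedMeasure ℝ) :
    AdditiveOn c d (fun s t => μ.variation.real (Ioc s t)) := by
  intro s m t _ h2 h3 _
  have := isFiniteMeasure_variation μ
  rw [← measureReal_union (Set.Ioc_disjoint_Ioc_of_le le_rfl) measurableSet_Ioc,
    Ioc_union_Ioc_eq_Ioc h2 h3]

theorem integrableOn_stieltjes (μ : SignedMeasure ℝ) (hg : ContinuousOn g (Icc c d)) {s : Set ℝ}
    (hm : MeasurableSet s) (hs : s ⊆ Icc c d) : μ.IntegrableOn g s := by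
  have := isFiniteMeasure_variation μ
  rw [VectorMeasure.IntegrableOn, VectorMeasure.Integrable, VectorMeasure.variation_restrict hm]
  exact (hg.integrableOn_compact isCompact_Icc).mono_set hs

theorem additiveOn_setIntegral (μ : SignedMeasure ℝ) (hg : ContinuousOn g (Icc c d)) :
    AdditiveOn c d (fun s t => ∫ᵛ r in Ioc s t, g r ∂•μ) := by
  intro s m t h1 h2 h3 h4
  simp only
  rw [← Ioc_union_Ioc_eq_Ioc h2 h3]
  exact VectorMeasure.setIntegral_union (Set.Ioc_disjoint_Ioc_of_le le_rfl) measurableSet_Ioc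
    measurableSet_Ioc
    (integrableOn_stieltjes μ hg measurableSet_Ioc fun x hx =>
      ⟨h1.trans hx.1.le, hx.2.trans (h3.trans h4)⟩)
    (integrableOn_stieltjes μ hg measurableSet_Ioc fun x hx =>
      ⟨(h1.trans h2).trans hx.1.le, hx.2.trans h4⟩)

/-- The point `c` has no mass because `f` is continuous. Half-open intervals are preferred since
adjacent ones are disjoint, which gives additivity. -/
theorem stieltjesIntegral_eq_Ioc (hcd : c ≤ d) (hf : ContinuousOn f (Icc c d))
    (hb : BoundedVariationOn f (Icc c d)) (hg : ContinuousOn g (Icc c d)) :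
    stieltjesIntegral c d g f = ∫ᵛ r in Ioc c d, g r ∂•(stieltjes c d f) := by
  have h0 : ({c} : Set ℝ) ⊆ Icc c d := by simpa using hcd
  have hu : Icc c d = {c} ∪ Ioc c d := by
    rw [← Icc_union_Ioc_eq_Icc le_rfl hcd, Icc_self]
  rw [stieltjesIntegral, hu, VectorMeasure.setIntegral_union (by simp) (measurableSet_singleton c)
    measurableSet_Ioc (integrableOn_stieltjes _ hg (measurableSet_singleton c) h0)
    (integrableOn_stieltjes _ hg measurableSet_Ioc Ioc_subset_Icc_self),
    VectorMeasure.integral_singleton, stieltjes_singleton hcd hf hb]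
  simp

/-- The error of a one-term Riemann–Stieltjes sum, with the integrand frozen at the left end. -/
theorem abs_setIntegral_sub_le (hcd : c ≤ d) (hf : ContinuousOn f (Icc c d))
    (hb : BoundedVariationOn f (Icc c d)) (hg : ContinuousOn g (Icc c d)) {s t ε : ℝ}
    (hs : c ≤ s) (hst : s ≤ t) (ht : t ≤ d) (hε : ∀ r ∈ Icc s t, |g r - g s| ≤ ε) :
    |(∫ᵛ r in Ioc s t, g r ∂•(stieltjes c d f)) - g s * (f t - f s)| ≤
      ε * (stieltjes c d f).variation.real (Ioc s t) := by
  have := isFiniteMeasure_variation (stieltjes c d f)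
  have hi := integrableOn_stieltjes (stieltjes c d f) hg (measurableSet_Ioc (a := s) (b := t))
    fun x hx => ⟨hs.trans hx.1.le, hx.2.trans ht⟩
  have hi' := integrableOn_stieltjes (stieltjes c d f) (g := fun _ => g s) continuousOn_const
    (measurableSet_Ioc (a := s) (b := t)) fun x hx => ⟨hs.trans hx.1.le, hx.2.trans ht⟩
  have hconst : g s * (f t - f s) = ∫ᵛ _ in Ioc s t, g s ∂•(stieltjes c d f) := by
    rw [VectorMeasure.setIntegral_const, stieltjes_Ioc hcd hf hb hs hst ht]
    simp
  rw [hconst, ← VectorMeasure.integral_fun_sub hi hi', ← Real.norm_eq_abs]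
  have := VectorMeasure.norm_setIntegral_le_of_norm_le_const (μ := stieltjes c d f)
    (f := fun r => g r - g s) (B := ContinuousLinearMap.lsmul ℝ ℝ) (s := Ioc s t) (C := ε)
    fun r hr => hε r ⟨hr.1.le, hr.2⟩
  simpa using this

end Stieltjes

theorem IsCBV.coord {c d : ℝ} {x : ℝ → Plane} (h : IsCBV c d x) (i : Fin 2) :
    ContinuousOn (fun t => x t i) (Icc c d) ∧ BoundedVariationOn (fun t => x t i) (Icc c d) := by
  have hl : LipschitzWith 1 (fun p : Plane => p i) :=
    LipschitzWith.of_dist_le_mul fun p q => by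
      simpa [dist_eq_norm] using PiLp.norm_apply_le (p - q) i
  exact ⟨hl.continuous.comp_continuousOn h.1, hl.comp_boundedVariationOn h.2⟩

/-- The curve area functional extends to an additive function of subintervals that is close to
the area functional of the chord. -/
theorem IsCBV.exists_additive_area {c d : ℝ} {x : ℝ → Plane} (hcd : c ≤ d) (h : IsCBV c d x) :
    ∃ J V : ℝ → ℝ → ℝ, AdditiveOn c d J ∧ AdditiveOn c d V ∧ J c d = curveArea c d x ∧
      (∀ s t, c ≤ s → s ≤ t → t ≤ d → ∀ i, |x t i - x s i| ≤ V s t) ∧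
      ∀ ε > 0, ∃ δ > 0, ∀ s t, c ≤ s → s ≤ t → t ≤ d → t - s < δ →
        |J s t - segArea (x s) (x t)| ≤ ε * V s t := by
  have h0 := h.coord 0
  have h1 := h.coord 1
  refine ⟨fun s t => 2⁻¹ * ((∫ᵛ r in Ioc s t, x r 0 ∂•(stieltjes c d fun t => x t 1)) -
      ∫ᵛ r in Ioc s t, x r 1 ∂•(stieltjes c d fun t => x t 0)),
    fun s t => (stieltjes c d fun t => x t 0).variation.real (Ioc s t) +
      (stieltjes c d fun t => x t 1).variation.real (Ioc s t),
    ((additiveOn_setIntegral _ h0.1).sub (additiveOn_setIntegral _ h1.1)).const_mul _,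
    (additiveOn_variation _).add (additiveOn_variation _), ?_, ?_, ?_⟩
  · rw [curveArea, stieltjesIntegral_eq_Ioc hcd h1.1 h1.2 h0.1,
      stieltjesIntegral_eq_Ioc hcd h0.1 h0.2 h1.1]
    ring
  · intro s t hs hst ht i
    have e0 := abs_increment_le_variation hcd h0.1 h0.2 hs hst ht
    have e1 := abs_increment_le_variation hcd h1.1 h1.2 hs hst ht
    have a0 := (abs_nonneg _).trans e0
    have a1 := (abs_nonneg _).trans e1
    fin_cases i
    · exact e0.trans (by linarith)
    · exact e1.trans (by linarith)
  · intro ε hε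
    have huc := isCompact_Icc.uniformContinuousOn_of_continuous h.1
    obtain ⟨δ, hδ, hd⟩ := Metric.uniformContinuousOn_iff.1 huc ε hε
    refine ⟨δ, hδ, fun s t hs hst ht hlt => ?_⟩
    have osc : ∀ i : Fin 2, ∀ r ∈ Icc s t, |x r i - x s i| ≤ ε := by
      intro i r hr
      have := hd r ⟨hs.trans hr.1, hr.2.trans ht⟩ s ⟨hs, hst.trans ht⟩ (by
        rw [Real.dist_eq, abs_of_nonneg (by linarith [hr.1])]; linarith [hr.2])
      refine le_trans ?_ this.le
      simpa [dist_eq_norm] using PiLp.norm_apply_le (x r - x s) i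
    -- Since `x s × x s = 0`, the chord area is `½ x s × (x t - x s)`, a one-term Riemann–Stieltjes
    -- sum.
    have e1 := abs_setIntegral_sub_le hcd h1.1 h1.2 h0.1 hs hst ht (osc 0)
    have e0 := abs_setIntegral_sub_le hcd h0.1 h0.2 h1.1 hs hst ht (osc 1)
    rw [abs_le] at e0 e1 ⊢
    simp only [segArea, cross]
    have p0 : 0 ≤ ε * (stieltjes c d fun t => x t 0).variation.real (Ioc s t) := by positivity
    have p1 : 0 ≤ ε * (stieltjes c d fun t => x t 1).variation.real (Ioc s t) := by positivity
    constructor <;> nlinarith [e0.1, e0.2, e1.1, e1.2]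

/-! ### Independence of the parametrization -/

/-- Two rectifiable parametrizations of an oriented Jordan arc differ by a continuous monotone
change of parameter. -/
theorem IsArcParam.exists_reparam {Γ : Set Plane} {p q : Plane} {c d c' d' : ℝ} {x y : ℝ → Plane}
    (hx : IsArcParam Γ p q c d x) (hy : IsArcParam Γ p q c' d' y) :
    ∃ φ : ℝ → ℝ, ContinuousOn φ (Icc c d) ∧ MonotoneOn φ (Icc c d) ∧
      MapsTo φ (Icc c d) (Icc c' d') ∧ φ c = c' ∧ φ d = d' ∧ ∀ t ∈ Icc c d, y (φ t) = x t := by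
  have hex : ∀ t ∈ Icc c d, ∃ r ∈ Icc c' d', y r = x t := fun t ht => by
    have : x t ∈ y '' Icc c' d' := by
      rw [hy.image_eq, ← hx.image_eq]
      exact mem_image_of_mem _ ht
    exact this
  choose! φ hmem hφ using hex
  have hm : MapsTo φ (Icc c d) (Icc c' d') := hmem
  have hcm : c ∈ Icc c d := left_mem_Icc.2 hx.le
  have hdm : d ∈ Icc c d := right_mem_Icc.2 hx.le
  have hc : φ c = c' := hy.injOn (hm hcm) (left_mem_Icc.2 hy.le)
    (by rw [hφ c hcm, hx.start_eq, hy.start_eq])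
  have hd : φ d = d' := hy.injOn (hm hdm) (right_mem_Icc.2 hy.le)
    (by rw [hφ d hdm, hx.end_eq, hy.end_eq])
  -- On a compact interval the injective continuous `y` is an embedding, so continuity of `y ∘ φ =
  -- x` passes to `φ`.
  have hcont : ContinuousOn φ (Icc c d) := by
    have hemb : Topology.IsEmbedding ((Icc c' d').domRestrict y) :=
      (hy.cbv.1.domRestrict.isClosedEmbedding hy.injOn.injective).isEmbedding
    have : Continuous fun t : Icc c d => (⟨φ t, hm t.2⟩ : Icc c' d') := by
      rw [hemb.continuous_iff]
      have : (Icc c' d').domRestrict y ∘ (fun t : Icc c d => (⟨φ t, hm t.2⟩ : Icc c' d')) =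
          (Icc c d).domRestrict x := by
        funext t
        exact hφ t t.2
      rw [this]
      exact hx.cbv.1.domRestrict
    rw [continuousOn_iff_continuous_domRestrict]
    exact continuous_subtype_val.comp this
  have hinj : InjOn φ (Icc c d) := fun s hs t ht h =>
    hx.injOn hs ht (by rw [← hφ s hs, ← hφ t ht, h])
  -- The common start and end points make the continuous injection `φ` increasing rather than
  -- decreasing.
  exact ⟨φ, hcont, (hcont.strictMonoOn_of_injOn_Icc hx.le (by rw [hc, hd]; exact hy.le)
    hinj).monotoneOn, hm, hc, hd, hφ⟩

/-- Corresponding intervals have the same chord, so the two additive areas differ by at most `ε`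
times an additive function on short intervals. No change of variables in the integral is needed. -/
theorem IsArcParam.curveArea_eq {Γ : Set Plane} {p q : Plane} {c d c' d' : ℝ} {x y : ℝ → Plane}
    (hx : IsArcParam Γ p q c d x) (hy : IsArcParam Γ p q c' d' y) :
    curveArea c d x = curveArea c' d' y := by
  obtain ⟨φ, hcont, hmono, hm, hc, hd, hφ⟩ := hx.exists_reparam hy
  obtain ⟨J, V, hJ, hV, hJx, -, hJe⟩ := hx.cbv.exists_additive_area hx.le
  obtain ⟨J', V', hJ', hV', hJy, -, hJe'⟩ := hy.cbv.exists_additive_area hy.le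
  have hz : AdditiveOn c d (fun _ _ => 0) := fun _ _ _ _ _ _ _ => by simp
  have := (hJ.sub (hJ'.comp hmono hm)).abs_le_of_forall_eps hz (hV.add (hV'.comp hmono hm)) ?_ hx.le
  · rw [hc, hd, hJx, hJy] at this
    linarith [abs_nonpos_iff.1 this]
  · intro ε hε
    obtain ⟨δ, hδ, h1⟩ := hJe ε hε
    obtain ⟨δ', hδ', h2⟩ := hJe' ε hε
    obtain ⟨η, hη, h3⟩ := Metric.uniformContinuousOn_iff.1
      (isCompact_Icc.uniformContinuousOn_of_continuous hcont) δ' hδ'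
    refine ⟨min δ η, lt_min hδ hη, fun s t hs hst ht hlt => ?_⟩
    have ms : s ∈ Icc c d := ⟨hs, hst.trans ht⟩
    have mt : t ∈ Icc c d := ⟨hs.trans hst, ht⟩
    have e1 := h1 s t hs hst ht (hlt.trans_le (min_le_left _ _))
    have hd' := h3 t mt s ms (by
      rw [Real.dist_eq, abs_of_nonneg (by linarith)]
      exact hlt.trans_le (min_le_right _ _))
    have hle := hmono ms mt hst
    rw [Real.dist_eq, abs_of_nonneg (by linarith)] at hd'
    have e2 := h2 (φ s) (φ t) (hm ms).1 hle (hm mt).2 hd'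
    rw [hφ s ms, hφ t mt] at e2
    rw [abs_le] at e1 e2 ⊢
    constructor <;> linarith [e1.1, e1.2, e2.1, e2.2]

theorem IsArcParam.curveArea_eq_arcArea {Γ : Set Plane} {p q : Plane} {c d : ℝ} {x : ℝ → Plane}
    (hx : IsArcParam Γ p q c d x) : curveArea c d x = arcArea Γ p q := by
  have h : IsRectifiableArc Γ p q := ⟨c, d, x, hx⟩
  rw [arcArea, dif_pos h]
  exact hx.curveArea_eq h.choose_spec.choose_spec.choose_spec

/-! ### Coordinates -/

theorem inner_u (p : Plane) (t : ℝ) :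
    (inner ℝ p (u t) : ℝ) = p 0 * Real.cos t + p 1 * Real.sin t := by
  simp [u, PiLp.inner_apply, Fin.sum_univ_two]
  ring

theorem inner_v (p : Plane) (t : ℝ) :
    (inner ℝ p (v t) : ℝ) = p 1 * Real.cos t - p 0 * Real.sin t := by
  simp [v, PiLp.inner_apply, Fin.sum_univ_two]
  ring

theorem inner_u_rotate (p : Plane) (m t : ℝ) :
    (inner ℝ p (u t) : ℝ) =
      inner ℝ p (u m) * Real.cos (t - m) + inner ℝ p (v m) * Real.sin (t - m) := by
  have h := Real.sin_sq_add_cos_sq m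
  simp only [inner_u, inner_v, Real.cos_sub, Real.sin_sub]
  linear_combination (-(p 0 * Real.cos t + p 1 * Real.sin t)) * h

theorem inner_v_rotate (p : Plane) (m t : ℝ) :
    (inner ℝ p (v t) : ℝ) =
      inner ℝ p (v m) * Real.cos (t - m) - inner ℝ p (u m) * Real.sin (t - m) := by
  have h := Real.sin_sq_add_cos_sq m
  simp only [inner_u, inner_v, Real.cos_sub, Real.sin_sub]
  linear_combination (-(p 1 * Real.cos t - p 0 * Real.sin t)) * h

theorem cross_eq (p q : Plane) (m : ℝ) :
    cross p q = inner ℝ p (u m) * inner ℝ q (v m) - inner ℝ p (v m) * inner ℝ q (u m) := by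
  have h := Real.sin_sq_add_cos_sq m
  simp only [inner_u, inner_v, cross]
  linear_combination (-(p 0 * q 1 - p 1 * q 0)) * h

theorem ext_inner_frame {p q : Plane} (t : ℝ) (hu : (inner ℝ p (u t) : ℝ) = inner ℝ q (u t))
    (hv : (inner ℝ p (v t) : ℝ) = inner ℝ q (v t)) : p = q := by
  rw [eq_frame p t, eq_frame q t, hu, hv]

/-! ### Support function and edges -/

theorem inner_le_supp (K : Body) (t : ℝ) {p : Plane} (hp : p ∈ (K : Set Plane)) :
    (inner ℝ p (u t) : ℝ) ≤ supp K t :=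
  le_csSup (K.isCompact.image (by fun_prop)).bddAbove (mem_image_of_mem _ hp)

theorem continuous_supp (K : Body) : Continuous (supp K) := by
  refine K.isCompact.continuous_sSup (f := fun (t : ℝ) (p : Plane) => (inner ℝ p (u t) : ℝ)) ?_
  simp only [Function.HasUncurry.uncurry, id, inner_u]
  fun_prop

theorem edge_convex (K : Body) (t : ℝ) : Convex ℝ (edge K t) := by
  refine K.convex.inter ?_
  intro p hp q hq x y hx hy hxy
  have hp' : (inner ℝ p (u t) : ℝ) = supp K t := hp
  have hq' : (inner ℝ q (u t) : ℝ) = supp K t := hq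
  change (inner ℝ (x • p + y • q) (u t) : ℝ) = supp K t
  rw [inner_add_left, real_inner_smul_left, real_inner_smul_left, hp', hq', ← add_mul, hxy, one_mul]

/-- Points of one edge differ by a multiple of `v t`, and `v t · v m = cos (t - m)`. -/
theorem inner_sub_of_mem_edge {K : Body} {p q : Plane} {t : ℝ} (m : ℝ) (hp : p ∈ edge K t) (hq : q ∈ edge K t) :
    (inner ℝ q (v m) : ℝ) - inner ℝ p (v m) =
      (inner ℝ q (v t) - inner ℝ p (v t)) * Real.cos (t - m) := by
  have h1 : (inner ℝ p (u t) : ℝ) = supp K t := hp.2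
  have h2 : (inner ℝ q (u t) : ℝ) = supp K t := hq.2
  rw [inner_v_rotate q t m, inner_v_rotate p t m, h1, h2, ← Real.cos_neg, neg_sub]
  ring

/-- The directions whose edge meets a closed condition form a closed set. -/
theorem isClosed_exists_mem_edge (K : Body) {C : Set (ℝ × Plane)} (hC : IsClosed C) :
    IsClosed {t | ∃ p ∈ edge K t, (t, p) ∈ C} := by
  -- Projection of `ℝ × K` to `ℝ` is a closed map because `K` is compact.
  have : CompactSpace (K : Set Plane) := isCompact_iff_compactSpace.1 K.isCompact
  have hS : IsClosed {x : ℝ × (K : Set Plane) |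
      (inner ℝ (x.2 : Plane) (u x.1) : ℝ) = supp K x.1 ∧ (x.1, (x.2 : Plane)) ∈ C} := by
    refine IsClosed.inter (isClosed_eq ?_ ((continuous_supp K).comp continuous_fst))
      (hC.preimage (by fun_prop))
    simp only [inner_u]
    fun_prop
  convert! isClosedMap_fst_of_compactSpace _ hS using 1
  ext t
  constructor
  · rintro ⟨p, ⟨hpK, hp⟩, hc⟩
    exact ⟨(t, ⟨p, hpK⟩), ⟨hp, hc⟩, rfl⟩
  · rintro ⟨⟨t', p⟩, ⟨hp, hc⟩, rfl⟩
    exact ⟨p, ⟨p.2, hp⟩, hc⟩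

/-- The superlevel sets are closed: the function is upper semicontinuous. -/
theorem measurable_inner_vPlus (K : Body) :
    Measurable fun t => (inner ℝ (vPlus K t) (v t) : ℝ) := by
  refine measurable_of_Ici fun c => ?_
  have hC : IsClosed {x : ℝ × Plane | c ≤ (inner ℝ x.2 (v x.1) : ℝ)} := by
    refine isClosed_le continuous_const ?_
    simp only [inner_v]
    fun_prop
  convert! (isClosed_exists_mem_edge K hC).measurableSet using 1
  ext t
  exact ⟨fun h => ⟨_, vPlus_mem_edge K t, h⟩, fun ⟨p, hp, h⟩ => le_trans h (inner_le_vPlus K t hp)⟩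

/-! ### The boundary segment as a Lipschitz graph -/

/-- The directions in `[a, b]` make an angle with `m` whose cosine is at least `κ > 0`. -/
structure IsChart (a b m κ : ℝ) : Prop where
  pos : 0 < κ
  le_cos : ∀ t ∈ Icc a b, κ ≤ Real.cos (t - m)
  lt_pi : b < a + Real.pi

theorem isChart_mid {a b : ℝ} (hab : a < b) (hba : b < a + Real.pi) :
    IsChart a b ((a + b) / 2) (Real.cos ((b - a) / 2)) where
  pos := Real.cos_pos_of_mem_Ioo ⟨by linarith [Real.pi_pos], by linarith⟩
  le_cos t ht := by
    rw [← Real.cos_abs (t - _)]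
    refine Real.cos_le_cos_of_nonneg_of_le_pi (abs_nonneg _) (by linarith) ?_
    rw [abs_le]
    constructor <;> linarith [ht.1, ht.2]
  lt_pi := hba

namespace IsChart

variable {a b m κ : ℝ} (h : IsChart a b m κ) {s t : ℝ} {K : Body} {p q r r' : Plane}
include h

theorem cos_pos (ht : t ∈ Icc a b) : 0 < Real.cos (t - m) := h.pos.trans_le (h.le_cos t ht)

/-- As a graph over `v m`, the supporting line at `t` has slope `-tan (t - m)`. Differences of
tangents therefore measure how much the slope drops between two directions. -/
theorem tan_sub_tan (hs : s ∈ Icc a b) (ht : t ∈ Icc a b) :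
    Real.tan (t - m) - Real.tan (s - m) =
      Real.sin (t - s) / (Real.cos (t - m) * Real.cos (s - m)) := by
  have h1 := (h.cos_pos hs).ne'
  have h2 := (h.cos_pos ht).ne'
  have : t - s = (t - m) - (s - m) := by ring
  rw [this, Real.sin_sub, Real.tan_eq_sin_div_cos, Real.tan_eq_sin_div_cos]
  field_simp

theorem sin_nonneg (hs : s ∈ Icc a b) (ht : t ∈ Icc a b) (hst : s ≤ t) : 0 ≤ Real.sin (t - s) :=
  Real.sin_nonneg_of_nonneg_of_le_pi (by linarith) (by linarith [h.lt_pi, hs.1, ht.2])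

theorem tan_mono (hs : s ∈ Icc a b) (ht : t ∈ Icc a b) (hst : s ≤ t) :
    Real.tan (s - m) ≤ Real.tan (t - m) := by
  rw [← sub_nonneg, h.tan_sub_tan hs ht]
  exact div_nonneg (h.sin_nonneg hs ht hst) (mul_pos (h.cos_pos ht) (h.cos_pos hs)).le

theorem tan_sub_tan_le (hs : s ∈ Icc a b) (ht : t ∈ Icc a b) (hst : s ≤ t) :
    Real.tan (t - m) - Real.tan (s - m) ≤ (κ ^ 2)⁻¹ * (t - s) := by
  rw [h.tan_sub_tan hs ht, div_eq_inv_mul]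
  have hk := h.pos
  have hc : κ ^ 2 ≤ Real.cos (t - m) * Real.cos (s - m) := by
    rw [sq]
    exact mul_le_mul (h.le_cos t ht) (h.le_cos s hs) hk.le (h.cos_pos ht).le
  have := h.sin_nonneg hs ht hst
  gcongr
  exact Real.sin_le (by linarith)

theorem abs_tan_le (ht : t ∈ Icc a b) : |Real.tan (t - m)| ≤ κ⁻¹ := by
  rw [Real.tan_eq_sin_div_cos, abs_div, abs_of_pos (h.cos_pos ht), ← one_div]
  exact div_le_div₀ zero_le_one (Real.abs_sin_le_one _) h.pos (h.le_cos t ht)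

/-- The supporting line at `r` bounds the body from above in the coordinates of the chart. -/
theorem slope_le (ht : t ∈ Icc a b) (hr : r ∈ edge K t) (hq : q ∈ (K : Set Plane)) :
    (inner ℝ q (u m) : ℝ) - inner ℝ r (u m) ≤
      -Real.tan (t - m) * (inner ℝ q (v m) - inner ℝ r (v m)) := by
  have hc := h.cos_pos ht
  have h1 : (inner ℝ r (u t) : ℝ) = supp K t := hr.2
  have h2 := inner_le_supp K t hq
  rw [← h1, inner_u_rotate q m t, inner_u_rotate r m t] at h2
  rw [Real.tan_eq_sin_div_cos, ← mul_le_mul_iff_right₀ hc]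
  field_simp
  linarith

/-- Adding the two supporting inequalities gives `(tan (t - m) - tan (s - m)) * (q - p) · v m ≥ 0`.
-/
theorem inner_mono (hs : s ∈ Icc a b) (ht : t ∈ Icc a b) (hst : s < t) (hp : p ∈ edge K s)
    (hq : q ∈ edge K t) : (inner ℝ p (v m) : ℝ) ≤ inner ℝ q (v m) := by
  have h1 := h.slope_le hs hp hq.1
  have h2 := h.slope_le ht hq hp.1
  have h3 : 0 < Real.tan (t - m) - Real.tan (s - m) := by
    rw [h.tan_sub_tan hs ht]
    exact div_pos (Real.sin_pos_of_pos_of_lt_pi (by linarith)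
      (by linarith [h.lt_pi, hs.1, ht.2])) (mul_pos (h.cos_pos ht) (h.cos_pos hs))
  by_contra! hlt
  nlinarith

theorem edge_ext (ht : t ∈ Icc a b) (hp : p ∈ edge K t) (hq : q ∈ edge K t)
    (hpq : (inner ℝ p (v m) : ℝ) = inner ℝ q (v m)) : p = q := by
  have h1 := h.slope_le ht hp hq.1
  have h2 := h.slope_le ht hq hp.1
  rw [hpq, sub_self, mul_zero] at h1 h2
  exact ext_inner_frame m (by linarith) hpq

theorem inner_le_inner_vPlus (ht : t ∈ Icc a b) (hp : p ∈ edge K t) :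
    (inner ℝ p (v m) : ℝ) ≤ inner ℝ (vPlus K t) (v m) := by
  have := inner_sub_of_mem_edge m hp (vPlus_mem_edge K t)
  have := mul_nonneg (sub_nonneg.2 (inner_le_vPlus K t hp)) (h.cos_pos ht).le
  linarith

theorem inner_vMinus_le_inner (ht : t ∈ Icc a b) (hp : p ∈ edge K t) :
    (inner ℝ (vMinus K t) (v m) : ℝ) ≤ inner ℝ p (v m) := by
  have := inner_sub_of_mem_edge m (vMinus_mem_edge K t) hp
  have := mul_nonneg (sub_nonneg.2 (vMinus_le_inner K t hp)) (h.cos_pos ht).le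
  linarith

/-- Concavity: to the right of `p` no chord is steeper than the supporting line at `p`. If the
direction of `r` precedes `s`, then `inner_mono` forces `r` and `p` to have the same abscissa. -/
theorem slope_le_of_left (hs : s ∈ Icc a b) (hp : p ∈ edge K s) (ht : t ∈ Icc a b)
    (hr : r ∈ edge K t) (hr' : r' ∈ (K : Set Plane))
    (h1 : (inner ℝ p (v m) : ℝ) ≤ inner ℝ r (v m))
    (h2 : (inner ℝ r (v m) : ℝ) ≤ inner ℝ r' (v m)) :
    (inner ℝ r' (u m) : ℝ) - inner ℝ r (u m) ≤
      -Real.tan (s - m) * (inner ℝ r' (v m) - inner ℝ r (v m)) := by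
  rcases le_or_gt s t with hst | hst
  · refine (h.slope_le ht hr hr').trans ?_
    have := h.tan_mono hs ht hst
    nlinarith
  · have he : (inner ℝ r (v m) : ℝ) = inner ℝ p (v m) := le_antisymm (h.inner_mono ht hs hst hr hp) h1
    have e1 := h.slope_le hs hp hr'
    have e2 := h.slope_le ht hr hp.1
    rw [he, sub_self, mul_zero] at e2
    rw [he]
    linarith

theorem le_slope_of_right (hs : s ∈ Icc a b) (hp : p ∈ edge K s) (ht : t ∈ Icc a b)
    (hr : r ∈ edge K t) (hr' : r' ∈ (K : Set Plane))
    (h1 : (inner ℝ r (v m) : ℝ) ≤ inner ℝ p (v m))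
    (h2 : (inner ℝ r' (v m) : ℝ) ≤ inner ℝ r (v m)) :
    -Real.tan (s - m) * (inner ℝ r (v m) - inner ℝ r' (v m)) ≤
      (inner ℝ r (u m) : ℝ) - inner ℝ r' (u m) := by
  rcases le_or_gt t s with hst | hst
  · have := h.slope_le ht hr hr'
    have := h.tan_mono ht hs hst
    nlinarith
  · have he : (inner ℝ r (v m) : ℝ) = inner ℝ p (v m) := le_antisymm h1 (h.inner_mono hs ht hst hp hr)
    have e1 := h.slope_le hs hp hr'
    have e2 := h.slope_le ht hr hp.1
    rw [he, sub_self, mul_zero] at e2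
    rw [he]
    linarith

theorem abs_inner_u_sub_le (hs : s ∈ Icc a b) (hp : p ∈ edge K s) (ht : t ∈ Icc a b)
    (hq : q ∈ edge K t) :
    |(inner ℝ q (u m) : ℝ) - inner ℝ p (u m)| ≤ κ⁻¹ * |(inner ℝ q (v m) : ℝ) - inner ℝ p (v m)| := by
  have e1 := h.slope_le hs hp hq.1
  have e2 := h.slope_le ht hq hp.1
  have b1 : -Real.tan (s - m) * (inner ℝ q (v m) - inner ℝ p (v m)) ≤
      κ⁻¹ * |(inner ℝ q (v m) : ℝ) - inner ℝ p (v m)| := by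
    refine (le_abs_self _).trans ?_
    rw [abs_mul, abs_neg]
    gcongr
    exact h.abs_tan_le hs
  have b2 : -Real.tan (t - m) * (inner ℝ p (v m) - inner ℝ q (v m)) ≤
      κ⁻¹ * |(inner ℝ q (v m) : ℝ) - inner ℝ p (v m)| := by
    refine (le_abs_self _).trans ?_
    rw [abs_mul, abs_neg, abs_sub_comm]
    gcongr
    exact h.abs_tan_le ht
  rw [abs_le]
  constructor <;> linarith

/-- The bounds on the abscissa leave only `v_K^+(a)` of the edge at `a` and only `v_K^-(b)` of the
edge at `b`. -/
theorem mem_convexCurve_iff (hab : a < b) : p ∈ convexCurve K a b ↔ (∃ t ∈ Icc a b, p ∈ edge K t) ∧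
    (inner ℝ p (v m) : ℝ) ∈ Icc (inner ℝ (vPlus K a) (v m)) (inner ℝ (vMinus K b) (v m)) := by
  have ha : a ∈ Icc a b := left_mem_Icc.2 hab.le
  have hb : b ∈ Icc a b := right_mem_Icc.2 hab.le
  have hle := h.inner_mono ha hb hab (vPlus_mem_edge K a) (vMinus_mem_edge K b)
  constructor
  · rintro ((hp | hp) | hp)
    · rw [mem_singleton_iff.1 hp]
      exact ⟨⟨a, ha, vPlus_mem_edge K a⟩, le_rfl, hle⟩
    · obtain ⟨t, ht, hp⟩ := mem_iUnion₂.1 hp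
      have ht' := Ioo_subset_Icc_self ht
      exact ⟨⟨t, ht', hp⟩, h.inner_mono ha ht' ht.1 (vPlus_mem_edge K a) hp,
        h.inner_mono ht' hb ht.2 hp (vMinus_mem_edge K b)⟩
    · rw [mem_singleton_iff.1 hp]
      exact ⟨⟨b, hb, vMinus_mem_edge K b⟩, hle, le_rfl⟩
  · rintro ⟨⟨t, ht, hp⟩, h1, h2⟩
    rcases eq_or_lt_of_le ht.1 with rfl | hat
    · exact .inl (.inl (h.edge_ext ha hp (vPlus_mem_edge K a)
        (le_antisymm (h.inner_le_inner_vPlus ha hp) h1)))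
    rcases eq_or_lt_of_le ht.2 with rfl | htb
    · exact .inr (h.edge_ext hb hp (vMinus_mem_edge K t)
        (le_antisymm h2 (h.inner_vMinus_le_inner hb hp)))
    · exact .inl (.inr (mem_iUnion₂.2 ⟨t, ⟨hat, htb⟩, hp⟩))

/-- An intermediate value argument for edges. The directions whose edge reaches left of `x`, and
those whose edge reaches right of it, form closed sets covering `[a, b]`; by connectedness some edge
does both, and by convexity it meets the abscissa `x`. -/
theorem exists_mem_convexCurve (hab : a < b) {x : ℝ}
    (hx : x ∈ Icc (inner ℝ (vPlus K a) (v m) : ℝ) (inner ℝ (vMinus K b) (v m))) :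
    ∃ p ∈ convexCurve K a b, (inner ℝ p (v m) : ℝ) = x := by
  have ha : a ∈ Icc a b := left_mem_Icc.2 hab.le
  have hb : b ∈ Icc a b := right_mem_Icc.2 hab.le
  have hA : IsClosed {y : ℝ × Plane | (inner ℝ y.2 (v m) : ℝ) ≤ x} :=
    isClosed_le (by fun_prop) continuous_const
  have hB : IsClosed {y : ℝ × Plane | x ≤ (inner ℝ y.2 (v m) : ℝ)} :=
    isClosed_le continuous_const (by fun_prop)
  obtain ⟨t, ht, ⟨p, hp, hpx⟩, ⟨q, hq, hqx⟩⟩ := isPreconnected_closed_iff.1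
    (isPreconnected_Icc (a := a) (b := b)) _ _ (isClosed_exists_mem_edge K hA)
    (isClosed_exists_mem_edge K hB)
    (fun t _ => (le_total (inner ℝ (vPlus K t) (v m) : ℝ) x).imp
      (fun h => ⟨_, vPlus_mem_edge K t, h⟩) fun h => ⟨_, vPlus_mem_edge K t, h⟩)
    ⟨a, ha, _, vPlus_mem_edge K a, hx.1⟩ ⟨b, hb, _, vMinus_mem_edge K b, hx.2⟩
  obtain ⟨r, hr, hrx⟩ := (edge_convex K t).isPreconnected.intermediate_value hp hq
    (f := fun p => (inner ℝ p (v m) : ℝ)) (by fun_prop) ⟨hpx, hqx⟩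
  exact ⟨r, (h.mem_convexCurve_iff hab).2 ⟨⟨t, ht, hr⟩, by rw [← hrx] at hx; exact hx⟩, hrx⟩

/-- The boundary segment has a rectifiable parametrization by the coordinate along `v m`. -/
theorem exists_isArcParam (hab : a < b) (K : Body) :
    ∃ x : ℝ → Plane, IsArcParam (convexCurve K a b) (vPlus K a) (vMinus K b)
      (inner ℝ (vPlus K a) (v m)) (inner ℝ (vMinus K b) (v m)) x ∧
      (∀ y ∈ Icc (inner ℝ (vPlus K a) (v m) : ℝ) (inner ℝ (vMinus K b) (v m)),
        x y ∈ convexCurve K a b ∧ (inner ℝ (x y) (v m) : ℝ) = y) ∧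
      ∀ p ∈ convexCurve K a b, x (inner ℝ p (v m)) = p := by
  have ha : a ∈ Icc a b := left_mem_Icc.2 hab.le
  have hb : b ∈ Icc a b := right_mem_Icc.2 hab.le
  have hle := h.inner_mono ha hb hab (vPlus_mem_edge K a) (vMinus_mem_edge K b)
  choose! x hx hxv using fun y hy => h.exists_mem_convexCurve (K := K) hab (x := y) hy
  have inj : ∀ p ∈ convexCurve K a b, x (inner ℝ p (v m)) = p := by
    intro p hp
    obtain ⟨⟨t, ht, hpt⟩, hpi⟩ := (h.mem_convexCurve_iff hab).1 hp
    obtain ⟨⟨s, hs, hps⟩, -⟩ := (h.mem_convexCurve_iff hab).1 (hx _ hpi)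
    have := h.abs_inner_u_sub_le hs hps ht hpt
    rw [hxv _ hpi, sub_self, abs_zero, mul_zero] at this
    exact ext_inner_frame m (sub_eq_zero.1 (abs_nonpos_iff.1 this)).symm (hxv _ hpi)
  have hsa : vPlus K a ∈ convexCurve K a b := .inl (.inl rfl)
  have hsb : vMinus K b ∈ convexCurve K a b := .inr rfl
  have hk := h.pos
  have hu : ∀ t, ‖u t‖ = 1 := fun t => by
    simp [u, EuclideanSpace.norm_eq, Fin.sum_univ_two]
  have hv : ∀ t, ‖v t‖ = 1 := fun t => by
    simp [v, EuclideanSpace.norm_eq, Fin.sum_univ_two]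
  -- The constant is `κ⁻¹` for the ordinate along `u m` plus `1` for the abscissa.
  have hlip : LipschitzOnWith (Real.toNNReal (κ⁻¹ + 1)) x
      (Icc (inner ℝ (vPlus K a) (v m) : ℝ) (inner ℝ (vMinus K b) (v m))) := by
    refine LipschitzOnWith.of_dist_le_mul fun y hy y' hy' => ?_
    rw [Real.coe_toNNReal _ (by positivity), dist_eq_norm, Real.dist_eq]
    obtain ⟨⟨t, ht, hpt⟩, -⟩ := (h.mem_convexCurve_iff hab).1 (hx _ hy)
    obtain ⟨⟨s, hs, hps⟩, -⟩ := (h.mem_convexCurve_iff hab).1 (hx _ hy')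
    have := h.abs_inner_u_sub_le hs hps ht hpt
    rw [hxv _ hy, hxv _ hy'] at this
    have e : x y - x y' = ((inner ℝ (x y) (u m) : ℝ) - inner ℝ (x y') (u m)) • u m +
        (y - y') • v m := by
      rw [eq_frame (x y - x y') m, inner_sub_left, inner_sub_left, hxv _ hy, hxv _ hy']
    rw [e]
    refine (norm_add_le _ _).trans ?_
    rw [norm_smul, norm_smul, hu, hv, mul_one, mul_one, Real.norm_eq_abs, Real.norm_eq_abs]
    linarith
  refine ⟨x, ⟨hle, ⟨hlip.continuousOn, ?_⟩, ?_, ?_, inj _ hsa, inj _ hsb⟩,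
    fun y hy => ⟨hx y hy, hxv y hy⟩, inj⟩
  · have := hlip.comp_boundedVariationOn (g := id) (mapsTo_id _) (by simp)
    exact this
  · intro y hy y' hy' he
    rw [← hxv y hy, ← hxv y' hy', he]
  · ext p
    constructor
    · rintro ⟨y, hy, rfl⟩
      exact hx y hy
    · intro hp
      exact ⟨_, ((h.mem_convexCurve_iff hab).1 hp).2, inj p hp⟩

end IsChart

/-! ### Error estimates over a short range of directions -/

theorem cross_sub_sub (p r r' : Plane) :
    cross (r - p) (r' - r) = cross r r' - cross p r' + cross p r := by
  simp only [cross, PiLp.sub_apply]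
  ring

theorem abs_cos_sub_one_le {x : ℝ} (hx : 0 ≤ x) : |Real.cos x - 1| ≤ x := by
  have h1 := Real.one_sub_sq_div_two_le_cos (x := x)
  have h2 := Real.neg_one_le_cos x
  have h3 := Real.cos_le_one x
  rw [abs_of_nonpos (by linarith)]
  rcases le_total x 2 with h | h
  · nlinarith
  · linarith

theorem abs_sin_sub_self_le {x : ℝ} (hx : 0 ≤ x) (hx1 : x ≤ 1) : |Real.sin x - x| ≤ x ^ 2 := by
  rcases hx.eq_or_lt with rfl | hx
  · simp
  have h1 := Real.sin_gt_sub_cube hx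
  have h2 := Real.sin_lt hx
  rw [abs_of_nonpos (by linarith)]
  nlinarith [mul_nonneg (sq_nonneg x) (sub_nonneg.2 hx1), sq_nonneg x]

theorem abs_inner_v_le (p : Plane) (t : ℝ) {V : ℝ} (hp : ∀ i, |p i| ≤ V) :
    |(inner ℝ p (v t) : ℝ)| ≤ 2 * V := by
  rw [inner_v]
  refine (abs_sub _ _).trans ?_
  rw [abs_mul, abs_mul]
  have h0 := mul_le_mul (hp 0) (Real.abs_sin_le_one t) (abs_nonneg _) ((abs_nonneg _).trans (hp 0))
  have h1 := mul_le_mul (hp 1) (Real.abs_cos_le_one t) (abs_nonneg _) ((abs_nonneg _).trans (hp 1))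
  linarith

theorem inner_v_v (s t : ℝ) : (inner ℝ (v s) (v t) : ℝ) = Real.cos (t - s) := by
  rw [inner_v, Real.cos_sub]
  simp [v]
  ring

theorem eq_add_smul_v {K : Body} {t : ℝ} {p z : Plane} (hp : p ∈ edge K t)
    (hz : z ∈ suppLine K t) : z = p + (inner ℝ (z - p) (v t) : ℝ) • v t := by
  have h1 : (inner ℝ p (u t) : ℝ) = supp K t := hp.2
  have h2 : (inner ℝ z (u t) : ℝ) = supp K t := hz
  have := eq_frame (z - p) t
  rw [inner_sub_left (𝕜 := ℝ) z p (u t), h1, h2, sub_self, zero_smul, zero_add] at this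
  rw [← this, add_sub_cancel]

namespace IsChart

variable {a b m κ : ℝ} (h : IsChart a b m κ) {s t : ℝ} {K : Body} {p q : Plane}
include h

/-- The chords `p r` and `r r'` have slopes between those of the supporting lines at `p` and `q`.
The cross product is the difference of these slopes times both horizontal lengths. -/
theorem abs_cross_sub_le (hs : s ∈ Icc a b) (ht : t ∈ Icc a b) (hst : s ≤ t) {r r' : Plane}
    (hp : p ∈ edge K s) (hq : q ∈ edge K t) {t₁ t₂ : ℝ} (ht₁ : t₁ ∈ Icc a b) (hr : r ∈ edge K t₁)
    (ht₂ : t₂ ∈ Icc a b) (hr' : r' ∈ edge K t₂)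
    (h1 : (inner ℝ p (v m) : ℝ) ≤ inner ℝ r (v m))
    (h2 : (inner ℝ r (v m) : ℝ) ≤ inner ℝ r' (v m))
    (h3 : (inner ℝ r' (v m) : ℝ) ≤ inner ℝ q (v m)) :
    |cross (r - p) (r' - r)| ≤ (κ ^ 2)⁻¹ * (t - s) * (inner ℝ q (v m) - inner ℝ p (v m)) *
      (inner ℝ r' (v m) - inner ℝ r (v m)) := by
  have u1 := h.slope_le_of_left hs hp hs hp hr.1 le_rfl h1
  have u2 := h.slope_le_of_left hs hp ht₁ hr hr'.1 h1 h2
  have l1 := h.le_slope_of_right ht hq ht₁ hr hp.1 (h2.trans h3) h1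
  have l2 := h.le_slope_of_right ht hq ht₂ hr' hr.1 h3 h2
  have hT := h.tan_sub_tan_le hs ht hst
  have hX := sub_nonneg.2 h1
  have hY := sub_nonneg.2 h2
  have hXZ : (inner ℝ r (v m) : ℝ) - inner ℝ p (v m) ≤ inner ℝ q (v m) - inner ℝ p (v m) := by
    linarith
  have hk : 0 ≤ (κ ^ 2)⁻¹ * (t - s) := mul_nonneg (by positivity) (by linarith)
  rw [cross_eq _ _ m]
  simp only [inner_sub_left]
  set X := (inner ℝ r (v m) : ℝ) - inner ℝ p (v m)
  set Y := (inner ℝ r' (v m) : ℝ) - inner ℝ r (v m)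
  set Z := (inner ℝ q (v m) : ℝ) - inner ℝ p (v m)
  set D := (inner ℝ r (u m) : ℝ) - inner ℝ p (u m)
  set E := (inner ℝ r' (u m) : ℝ) - inner ℝ r (u m)
  have b1 := mul_le_mul_of_nonneg_right u1 hY
  have b2 := mul_le_mul_of_nonneg_left u2 hX
  have b3 := mul_le_mul_of_nonneg_right l1 hY
  have b4 := mul_le_mul_of_nonneg_left l2 hX
  have b5 : (Real.tan (t - m) - Real.tan (s - m)) * (X * Y) ≤ (κ ^ 2)⁻¹ * (t - s) * (X * Y) :=
    mul_le_mul_of_nonneg_right hT (mul_nonneg hX hY)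
  have b6 : (κ ^ 2)⁻¹ * (t - s) * (X * Y) ≤ (κ ^ 2)⁻¹ * (t - s) * (Z * Y) :=
    mul_le_mul_of_nonneg_left (mul_le_mul_of_nonneg_right hXZ hY) hk
  rw [abs_le]
  constructor <;> linarith

/-- The curve area functional of a piece of the boundary segment is close to that of its chord. -/
theorem abs_area_sub_segArea_le (hab : a < b) {x : ℝ → Plane} {J V : ℝ → ℝ → ℝ} {c d : ℝ}
    (hc : c = inner ℝ (vPlus K a) (v m)) (hd : d = inner ℝ (vMinus K b) (v m))
    (hx : ∀ y ∈ Icc c d, x y ∈ convexCurve K a b ∧ (inner ℝ (x y) (v m) : ℝ) = y)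
    (hinv : ∀ p ∈ convexCurve K a b, x (inner ℝ p (v m)) = p)
    (hJ : AdditiveOn c d J) (hV : AdditiveOn c d V)
    (hJV : ∀ ε > 0, ∃ δ > 0, ∀ s t, c ≤ s → s ≤ t → t ≤ d → t - s < δ →
      |J s t - segArea (x s) (x t)| ≤ ε * V s t)
    (hs : s ∈ Icc a b) (ht : t ∈ Icc a b) (hst : s ≤ t) (hp : p ∈ edge K s) (hq : q ∈ edge K t)
    (hpc : p ∈ convexCurve K a b) (hqc : q ∈ convexCurve K a b)
    (hpq : (inner ℝ p (v m) : ℝ) ≤ inner ℝ q (v m)) :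
    |J (inner ℝ p (v m)) (inner ℝ q (v m)) - segArea p q| ≤
      (κ ^ 2)⁻¹ * (t - s) * (inner ℝ q (v m) - inner ℝ p (v m)) *
        (inner ℝ q (v m) - inner ℝ p (v m)) := by
  have hpm := ((h.mem_convexCurve_iff hab).1 hpc).2
  have hqm := ((h.mem_convexCurve_iff hab).1 hqc).2
  rw [← hc, ← hd] at hpm hqm
  set y₀ := (inner ℝ p (v m) : ℝ) with hy₀
  set y₁ := (inner ℝ q (v m) : ℝ) with hy₁
  -- Subtracting the increment of `½ p × x` leaves, over a short interval, nearly the area of a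
  -- triangle with apex `p`. Its bound is linear in the interval length, hence additive.
  have hA := ((hJ.mono hpm.1 hqm.2).sub
    (AdditiveOn.increment fun y => 1 / 2 * cross p (x y)))
  have := hA.abs_le_of_forall_eps ((AdditiveOn.increment id).const_mul
    ((κ ^ 2)⁻¹ * (t - s) * (y₁ - y₀))) (hV.mono hpm.1 hqm.2) ?_ hpq
  · have e : segArea p q = 1 / 2 * cross p (x y₁) - 1 / 2 * cross p (x y₀) := by
      rw [hinv p hpc, hinv q hqc]
      simp only [segArea, cross]
      ring
    rw [e]
    exact this
  · intro ε hε
    obtain ⟨δ, hδ, hb⟩ := hJV ε hε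
    refine ⟨δ, hδ, fun y y' h1 h2 h3 h4 => ?_⟩
    have b1 := hb y y' (hpm.1.trans h1) h2 (h3.trans hqm.2) h4
    have my : y ∈ Icc c d := ⟨hpm.1.trans h1, h2.trans (h3.trans hqm.2)⟩
    have my' : y' ∈ Icc c d := ⟨hpm.1.trans (h1.trans h2), h3.trans hqm.2⟩
    obtain ⟨r1, r2⟩ := hx y my
    obtain ⟨r1', r2'⟩ := hx y' my'
    obtain ⟨⟨t₁, ht₁, hr⟩, -⟩ := (h.mem_convexCurve_iff hab).1 r1
    obtain ⟨⟨t₂, ht₂, hr'⟩, -⟩ := (h.mem_convexCurve_iff hab).1 r1'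
    have b2 := h.abs_cross_sub_le hs ht hst hp hq ht₁ hr ht₂ hr' (by rwa [r2]) (by rwa [r2, r2'])
      (by rwa [r2'])
    rw [r2, r2', cross_sub_sub, ← hy₀, ← hy₁] at b2
    simp only [segArea, id] at b1 ⊢
    rw [abs_le] at b1 b2 ⊢
    constructor <;> linarith [b1.1, b1.2, b2.1, b2.2]

/-- The slope of the chord `p q` lies between those of the two supporting lines, so its normal
component to either line is at most the slope drop times the horizontal length. -/
theorem inner_u_bounds (hs : s ∈ Icc a b) (ht : t ∈ Icc a b) (hst : s ≤ t) (hp : p ∈ edge K s)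
    (hq : q ∈ edge K t) (hpq : (inner ℝ p (v m) : ℝ) ≤ inner ℝ q (v m)) :
    |(inner ℝ (q - p) (u s) : ℝ)| ≤
        (κ ^ 2)⁻¹ * (t - s) * (inner ℝ q (v m) - inner ℝ p (v m)) ∧
      |(inner ℝ (q - p) (u t) : ℝ)| ≤
        (κ ^ 2)⁻¹ * (t - s) * (inner ℝ q (v m) - inner ℝ p (v m)) := by
  have e1 := h.slope_le hs hp hq.1
  have e2 := h.slope_le ht hq hp.1
  have hT := h.tan_sub_tan_le hs ht hst
  have hX := sub_nonneg.2 hpq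
  have key : ∀ r ∈ Icc a b, (inner ℝ (q - p) (u r) : ℝ) = Real.cos (r - m) *
      (inner ℝ q (u m) - inner ℝ p (u m) +
        Real.tan (r - m) * (inner ℝ q (v m) - inner ℝ p (v m))) := by
    intro r hr
    have := (h.cos_pos hr).ne'
    rw [inner_u_rotate _ m, inner_sub_left, inner_sub_left, Real.tan_eq_sin_div_cos]
    field_simp
  have hcos : ∀ r x, |Real.cos r * x| ≤ |x| := fun r x => by
    rw [abs_mul]
    exact mul_le_of_le_one_left (abs_nonneg _) (Real.abs_cos_le_one r)
  have hT' := mul_le_mul_of_nonneg_right hT hX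
  rw [key s hs, key t ht]
  refine ⟨(hcos _ _).trans ?_, (hcos _ _).trans ?_⟩ <;> rw [abs_le] <;> constructor <;> linarith

/-- For `p = q` the area is exactly `½ x y sin (t - s)`, as `v s × v t = sin (t - s)`. In general `q
- p` enters only through its components normal to the two supporting lines. -/
theorem abs_quad_le (hs : s ∈ Icc a b) (ht : t ∈ Icc a b) (hst : s ≤ t) (hp : p ∈ edge K s)
    (hq : q ∈ edge K t) (hpq : (inner ℝ p (v m) : ℝ) ≤ inner ℝ q (v m)) {x y B : ℝ} (hx : |x| ≤ B)
    (hy : |y| ≤ B) :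
    |segArea p (p + x • v s) + segArea (p + x • v s) (q + y • v t) - segArea q (q + y • v t)
        - segArea p q - 1 / 2 * (x * y * Real.sin (t - s))| ≤
      B * ((κ ^ 2)⁻¹ * (t - s) * (inner ℝ q (v m) - inner ℝ p (v m))) := by
  obtain ⟨e1, e2⟩ := h.inner_u_bounds hs ht hst hp hq hpq
  have e : segArea p (p + x • v s) + segArea (p + x • v s) (q + y • v t) - segArea q (q + y • v t)
        - segArea p q - 1 / 2 * (x * y * Real.sin (t - s)) =
      -(1 / 2) * (x * inner ℝ (q - p) (u s) + y * inner ℝ (q - p) (u t)) := by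
    rw [inner_u, inner_u, Real.sin_sub]
    simp [segArea, cross, v]
    ring
  have b1 := mul_le_mul hx e1 (abs_nonneg _) ((abs_nonneg _).trans hx)
  have b2 := mul_le_mul hy e2 (abs_nonneg _) ((abs_nonneg _).trans hx)
  rw [← abs_mul] at b1 b2
  rw [e]
  rw [abs_le] at b1 b2 ⊢
  constructor <;> linarith [b1.1, b1.2, b2.1, b2.2]

/-- The three terms come from the rotation of `v`, the motion of `z` and the motion of the vertex.
-/
theorem abs_tangent_sub_le (hs : s ∈ Icc a b) (ht : t ∈ Icc a b) (hst : s ≤ t)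
    (hp : p ∈ edge K s) (hq : q ∈ edge K t) (hpq : (inner ℝ p (v m) : ℝ) ≤ inner ℝ q (v m))
    {z z' : Plane} (hz : z ∈ suppLine K s) {B V : ℝ} (hB : |(inner ℝ (z - p) (v s) : ℝ)| ≤ B)
    (hV : ∀ i, |z' i - z i| ≤ V) :
    |(inner ℝ (z' - q) (v t) : ℝ) - inner ℝ (z - p) (v s)| ≤
      B * (t - s) + 2 * V + (1 + κ⁻¹) * (inner ℝ q (v m) - inner ℝ p (v m)) := by
  have e : (inner ℝ (z' - q) (v t) : ℝ) - inner ℝ (z - p) (v s) =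
      inner ℝ (z' - z) (v t) - inner ℝ (q - p) (v t) +
        inner ℝ (z - p) (v s) * (Real.cos (t - s) - 1) := by
    have := congrArg (fun w : Plane => (inner ℝ (w - p) (v t) : ℝ)) (eq_add_smul_v hp hz)
    simp only [add_sub_cancel_left, real_inner_smul_left, inner_v_v] at this
    simp only [inner_sub_left] at this ⊢
    linarith
  have b1 : |(inner ℝ (z' - z) (v t) : ℝ)| ≤ 2 * V := abs_inner_v_le _ _ hV
  have b2 : |(inner ℝ (q - p) (v t) : ℝ)| ≤
      (1 + κ⁻¹) * (inner ℝ q (v m) - inner ℝ p (v m)) := by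
    have hu := h.abs_inner_u_sub_le hs hp ht hq
    rw [abs_of_nonneg (sub_nonneg.2 hpq)] at hu
    rw [inner_v_rotate _ m, inner_sub_left, inner_sub_left]
    refine (abs_sub _ _).trans ?_
    rw [abs_mul, abs_mul, abs_of_nonneg (sub_nonneg.2 hpq)]
    have c1 := mul_le_of_le_one_right (sub_nonneg.2 hpq) (Real.abs_cos_le_one (t - m))
    have c2 := mul_le_of_le_one_right (abs_nonneg ((inner ℝ q (u m) : ℝ) - inner ℝ p (u m)))
      (Real.abs_sin_le_one (t - m))
    linarith
  have b3 : |(inner ℝ (z - p) (v s) : ℝ) * (Real.cos (t - s) - 1)| ≤ B * (t - s) := by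
    rw [abs_mul]
    exact mul_le_mul hB (abs_cos_sub_one_le (by linarith)) (abs_nonneg _)
      ((abs_nonneg _).trans hB)
  rw [e]
  rw [abs_le] at b1 b2 b3 ⊢
  constructor <;> linarith [b1.1, b1.2, b2.1, b2.2, b3.1, b3.2]

end IsChart

/-- The right-hand vertices, closed up by `v_K^-(b)` at the last direction. -/
noncomputable def arcVertex (K : Body) (b t : ℝ) : Plane :=
  if t < b then vPlus K t else vMinus K b

theorem arcVertex_of_lt {K : Body} {b t : ℝ} (h : t < b) : arcVertex K b t = vPlus K t := if_pos h

theorem arcVertex_self (K : Body) (b : ℝ) : arcVertex K b b = vMinus K b := if_neg (lt_irrefl b)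

theorem arcVertex_mem_edge (K : Body) {b t : ℝ} (h : t ≤ b) : arcVertex K b t ∈ edge K t := by
  rcases h.eq_or_lt with rfl | h
  · rw [arcVertex_self]
    exact vMinus_mem_edge K t
  · rw [arcVertex_of_lt h]
    exact vPlus_mem_edge K t

theorem arcVertex_mem_convexCurve (K : Body) {a b t : ℝ} (ht : t ∈ Icc a b) :
    arcVertex K b t ∈ convexCurve K a b := by
  rcases ht.2.eq_or_lt with rfl | h
  · rw [arcVertex_self]
    exact .inr rfl
  rw [arcVertex_of_lt h]
  rcases ht.1.eq_or_lt with rfl | h'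
  · exact .inl (.inl rfl)
  · exact .inl (.inr (mem_iUnion₂.2 ⟨t, ⟨h', h⟩, vPlus_mem_edge K t⟩))

theorem IsChart.monotoneOn_arcVertex {a b m κ : ℝ} (h : IsChart a b m κ) (K : Body) :
    MonotoneOn (fun t => (inner ℝ (arcVertex K b t) (v m) : ℝ)) (Icc a b) := by
  intro s hs t ht hst
  rcases hst.eq_or_lt with rfl | hst
  · exact le_rfl
  · exact h.inner_mono hs ht hst (arcVertex_mem_edge K hs.2) (arcVertex_mem_edge K ht.2)

/-! ### The tangent length -/

section TangentLength

variable {a b : ℝ} {K : Body} {z : ℝ → Plane}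

theorem eq_vPlus_add_tangentLength {t : ℝ} (hz : z t ∈ suppLine K t) :
    z t = vPlus K t + tangentLength K z t • v t :=
  eq_add_smul_v (vPlus_mem_edge K t) hz

/-- Uniform over `K`, so that it applies to `vPlus` and to `arcVertex`. -/
theorem exists_inner_bound (K : Body) (hz : ContinuousOn z (Icc a b)) :
    ∃ C : ℝ, ∀ t ∈ Icc a b, ∀ p ∈ (K : Set Plane), |(inner ℝ (z t - p) (v t) : ℝ)| ≤ C := by
  obtain ⟨C, hC⟩ := (isCompact_Icc.image_of_continuousOn hz).isBounded.exists_norm_le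
  obtain ⟨C', hC'⟩ := K.isBounded.exists_norm_le
  refine ⟨2 * (C + C'), fun t ht p hp => abs_inner_v_le _ _ fun i => ?_⟩
  exact (PiLp.norm_apply_le (z t - p) i).trans ((norm_sub_le _ _).trans
    (add_le_add (hC _ (mem_image_of_mem _ ht)) (hC' _ hp)))

theorem exists_tangentLength_bound (K : Body) (hz : ContinuousOn z (Icc a b)) :
    ∃ C : ℝ, ∀ t ∈ Icc a b, |tangentLength K z t| ≤ C := by
  obtain ⟨C, hC⟩ := exists_inner_bound K hz
  exact ⟨C, fun t ht => hC t ht _ (vPlus_mem_edge K t).1⟩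

theorem measurable_domRestrict_tangentLength (K : Body) (hz : ContinuousOn z (Icc a b)) :
    Measurable ((Icc a b).domRestrict (tangentLength K z)) := by
  have hc : ∀ i, Continuous fun t : Icc a b => z t i := fun i =>
    (PiLp.continuous_apply 2 _ i).comp (continuousOn_iff_continuous_domRestrict.1 hz)
  have h1 : Measurable fun t : Icc a b => (inner ℝ (z t) (v t) : ℝ) := by
    have : Continuous fun t : Icc a b => z t 1 * Real.cos t - z t 0 * Real.sin t :=
      ((hc 1).mul (by fun_prop)).sub ((hc 0).mul (by fun_prop))
    simpa only [inner_v] using this.measurable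
  have h2 : Measurable fun t : Icc a b => (inner ℝ (vPlus K t) (v t) : ℝ) :=
    (measurable_inner_vPlus K).comp measurable_subtype_coe
  have e : (Icc a b).domRestrict (tangentLength K z) =
      fun t : Icc a b => (inner ℝ (z t) (v t) : ℝ) - inner ℝ (vPlus K t) (v t) := by
    funext t
    exact inner_sub_left _ _ _
  rw [e]
  exact h1.sub h2

theorem aemeasurable_tangentLength (K : Body) (hz : ContinuousOn z (Icc a b)) :
    AEMeasurable (tangentLength K z) (volume.restrict (Icc a b)) :=
  (aemeasurable_restrict_iff_comap_subtype measurableSet_Icc).2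
    (measurable_domRestrict_tangentLength K hz).aemeasurable

theorem intervalIntegrable_tangentLength_mul {s t : ℝ} {K L : Body} {z w : ℝ → Plane}
    (hz : ContinuousOn z (Icc a b)) (hw : ContinuousOn w (Icc a b)) (hs : a ≤ s) (hst : s ≤ t)
    (ht : t ≤ b) :
    IntervalIntegrable (fun r => tangentLength K z r * tangentLength L w r) volume s t := by
  rw [intervalIntegrable_iff_integrableOn_Icc_of_le hst]
  obtain ⟨C, hC⟩ := exists_tangentLength_bound K hz
  obtain ⟨C', hC'⟩ := exists_tangentLength_bound L hw
  refine IntegrableOn.mono_set (t := Icc a b) ?_ (Icc_subset_Icc hs ht)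
  have hm : AEStronglyMeasurable (fun r => tangentLength K z r * tangentLength L w r)
      (volume.restrict (Icc a b)) :=
    ((aemeasurable_tangentLength K hz).mul (aemeasurable_tangentLength L hw)).aestronglyMeasurable
  refine Integrable.of_bound hm (C * C') ?_
  filter_upwards [ae_restrict_mem measurableSet_Icc] with r hr
  rw [norm_mul]
  exact mul_le_mul (hC r hr) (hC' r hr) (abs_nonneg _) ((abs_nonneg _).trans (hC r hr))

theorem intervalIntegrable_tangentLength_sq {s t : ℝ} (hz : ContinuousOn z (Icc a b))
    (hs : a ≤ s) (hst : s ≤ t) (ht : t ≤ b) :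
    IntervalIntegrable (fun r => tangentLength K z r ^ 2) volume s t := by
  simpa only [sq] using intervalIntegrable_tangentLength_mul hz hz hs hst ht

end TangentLength

/-! ### The generalized Mamikon theorem -/

theorem segArea_swap (p q : Plane) : segArea p q = -segArea q p := by
  simp only [segArea, cross]
  ring

/-- The integral of the squared tangent length over a short interval. -/
theorem abs_integral_sub_le {f : ℝ → ℝ} {s t x y B E : ℝ} (hst : s ≤ t) (ht1 : t - s ≤ 1)
    (hf : IntervalIntegrable (fun r => f r ^ 2) volume s t) (hx : |x| ≤ B) (hy : |y| ≤ B)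
    (hB : ∀ r ∈ Ioo s t, |f r| ≤ B) (hE : ∀ r ∈ Ioo s t, |f r - x| ≤ E) (hxy : |y - x| ≤ E) :
    |x * y * Real.sin (t - s) - ∫ r in s..t, f r ^ 2| ≤ (t - s) * (B ^ 2 * (t - s) + 3 * B * E) := by
  have hB0 : 0 ≤ B := (abs_nonneg _).trans hx
  have hE0 : 0 ≤ E := (abs_nonneg _).trans hxy
  have h0 : 0 ≤ t - s := sub_nonneg.2 hst
  have e : ∫ r in s..t, (x * y - f r ^ 2) = x * y * (t - s) - ∫ r in s..t, f r ^ 2 := by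
    rw [intervalIntegral.integral_sub intervalIntegrable_const hf, intervalIntegral.integral_const,
      smul_eq_mul, mul_comm (t - s)]
  have b1 : ‖∫ r in s..t, (x * y - f r ^ 2)‖ ≤ 3 * B * E * |t - s| := by
    refine intervalIntegral.norm_integral_le_of_norm_le_const_ae ?_
    -- The right end is discarded as a null set, since nothing is assumed about `f` there.
    have : ∀ᵐ r : ℝ, r ≠ t := by simp [ae_iff, measure_singleton]
    filter_upwards [this] with r hrt hr
    rw [uIoc_of_le hst] at hr
    have hr' : r ∈ Ioo s t := ⟨hr.1, lt_of_le_of_ne hr.2 hrt⟩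
    have c : x * y - f r ^ 2 = x * (y - x) - (f r - x) * (f r + x) := by ring
    have c1 : |x * (y - x)| ≤ B * E := by
      rw [abs_mul]
      gcongr
    have c2 : |(f r - x) * (f r + x)| ≤ E * (B + B) := by
      rw [abs_mul]
      gcongr
      · exact hE r hr'
      · exact (abs_add_le _ _).trans (add_le_add (hB r hr') hx)
    rw [c, Real.norm_eq_abs]
    refine (abs_sub _ _).trans ?_
    linarith
  have b2 : |x * y * (Real.sin (t - s) - (t - s))| ≤ B * B * (t - s) ^ 2 := by
    rw [abs_mul, abs_mul]
    gcongr
    exact abs_sin_sub_self_le h0 ht1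
  rw [e, Real.norm_eq_abs, abs_of_nonneg h0] at b1
  rw [abs_le] at b1 b2 ⊢
  constructor <;> linarith [b1.1, b1.2, b2.1, b2.2]

theorem IsChart.mamikonArea_eq {a b m κ : ℝ} (h : IsChart a b m κ) (hab : a < b) (K : Body)
    {z : ℝ → Plane} (hz : IsCBV a b z) (hzK : ∀ t ∈ Icc a b, z t ∈ suppLine K t) :
    mamikonArea K a b z = (1 / 2) * ∫ t in a..b, tangentLength K z t ^ 2 := by
  obtain ⟨x, hx, hxc, hxi⟩ := h.exists_isArcParam hab K
  obtain ⟨J, V, hJ, hV, hJx, -, hJV⟩ := hx.cbv.exists_additive_area hx.le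
  obtain ⟨Jz, Vz, hJz, hVz, hJzz, hVzz, hJVz⟩ := hz.exists_additive_area hab.le
  obtain ⟨B, hB⟩ := exists_inner_bound K hz.1
  set w := arcVertex K b with hw
  set σ := fun t => (inner ℝ (w t) (v m) : ℝ) with hσ
  set β := fun t => (inner ℝ (z t - w t) (v t) : ℝ) with hβ
  have hσm : MonotoneOn σ (Icc a b) := h.monotoneOn_arcVertex K
  have hwe : ∀ t ∈ Icc a b, w t ∈ edge K t := fun t ht => arcVertex_mem_edge K ht.2
  have hwc : ∀ t ∈ Icc a b, w t ∈ convexCurve K a b := fun t ht => arcVertex_mem_convexCurve K ht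
  have hwa : w a = vPlus K a := arcVertex_of_lt hab
  have hwb : w b = vMinus K b := arcVertex_self K b
  have hβB : ∀ t ∈ Icc a b, |β t| ≤ B := fun t ht => hB t ht _ (hwe t ht).1
  have hB0 : 0 ≤ B := (abs_nonneg _).trans (hβB a (left_mem_Icc.2 hab.le))
  have hk := h.pos
  have hσmaps : MapsTo σ (Icc a b)
      (Icc (inner ℝ (vPlus K a) (v m)) (inner ℝ (vMinus K b) (v m))) :=
    fun t ht => ((h.mem_convexCurve_iff hab).1 (hwc t ht)).2
  have hint : AdditiveOn a b fun s t => ∫ r in s..t, tangentLength K z r ^ 2 := by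
    intro s r t h1 h2 h3 h4
    exact (intervalIntegral.integral_add_adjacent_intervals
      (intervalIntegrable_tangentLength_sq hz.1 h1 h2 (h3.trans h4))
      (intervalIntegrable_tangentLength_sq hz.1 (h1.trans h2) h3 h4)).symm
  -- The additive defect: its value on `[a, b]` is the swept area minus `½ ∫ α²`.
  have hA := (((hJz.sub (AdditiveOn.increment fun t => segArea (w t) (z t))).sub
    (hJ.comp hσm hσmaps)).sub (hint.const_mul (1 / 2)))
  have hW : AdditiveOn a b fun s t => (t - s) + Vz s t + (σ t - σ s) :=
    ((AdditiveOn.increment fun t => t).add hVz).add (AdditiveOn.increment σ)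
  set R := σ b - σ a with hR
  set L := B + 2 + (1 + κ⁻¹) with hL
  -- The summands of `C` come from the quadrilateral, from the boundary piece against its chord, and
  -- from the integral.
  set C := B * (κ ^ 2)⁻¹ + (κ ^ 2)⁻¹ * R + (B ^ 2 + 3 * B * L) with hC
  have h0 : AdditiveOn a b (fun _ _ => 0) := fun _ _ _ _ _ _ _ => by simp
  have key := hA.abs_le_of_forall_eps h0
    ((hW.const_mul C).add hVz) ?_ hab.le
  · have := abs_nonpos_iff.1 key
    simp only [hσ, hwa, hwb, hJx, hJzz] at this
    rw [mamikonArea, ← hx.curveArea_eq_arcArea, segArea_swap (z b)]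
    linarith
  · intro ε hε
    obtain ⟨δ, hδ, hδz⟩ := hJVz ε hε
    -- `δ` serves the chords of `z`, `1` the sine estimate, and `ε` turns the factor `t - s` of the
    -- other errors into `ε`.
    refine ⟨min δ (min 1 ε), lt_min hδ (lt_min one_pos hε), fun s t has hst htb hlt => ?_⟩
    have hlt1 : t - s < 1 := hlt.trans_le ((min_le_right _ _).trans (min_le_left _ _))
    have hltε : t - s < ε := hlt.trans_le ((min_le_right _ _).trans (min_le_right _ _))
    have hs : s ∈ Icc a b := ⟨has, hst.trans htb⟩
    have ht : t ∈ Icc a b := ⟨has.trans hst, htb⟩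
    have bz := hδz s t has hst htb (hlt.trans_le (min_le_left _ _))
    have hzw : ∀ r ∈ Icc a b, z r = w r + β r • v r :=
      fun r hr => eq_add_smul_v (hwe r hr) (hzK r hr)
    have bq := h.abs_quad_le hs ht hst (hwe s hs) (hwe t ht) (hσm hs ht hst) (hβB s hs) (hβB t ht)
    rw [← hzw s hs, ← hzw t ht] at bq
    have ba := h.abs_area_sub_segArea_le hab rfl rfl hxc hxi hJ hV hJV hs ht hst (hwe s hs)
      (hwe t ht) (hwc s hs) (hwc t ht) (hσm hs ht hst)
    have hVnonneg : ∀ r r', a ≤ r → r ≤ r' → r' ≤ b → 0 ≤ Vz r r' :=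
      fun r r' h1 h2 h3 => (abs_nonneg _).trans (hVzz r r' h1 h2 h3 0)
    set W := (t - s) + Vz s t + (σ t - σ s) with hWdef
    have hΔ : 0 ≤ σ t - σ s := sub_nonneg.2 (hσm hs ht hst)
    have hVst := hVnonneg s t has hst htb
    have hdiff : ∀ r ∈ Icc s t, |β r - β s| ≤ L * W := by
      intro r hr
      have hrm : r ∈ Icc a b := ⟨has.trans hr.1, hr.2.trans htb⟩
      have e := h.abs_tangent_sub_le hs hrm hr.1 (hwe s hs) (hwe r hrm) (hσm hs hrm hr.1)
        (hzK s hs) (hβB s hs) (hVzz s r has hr.1 hrm.2)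
      refine e.trans ?_
      have e1 : Vz s r ≤ Vz s t := by
        rw [hVz has hr.1 hr.2 htb]
        linarith [hVnonneg r t hrm.1 hr.2 htb]
      have e2 : σ r ≤ σ t := hσm hrm ht hr.2
      have e3 : B * (r - s) ≤ B * W := by
        gcongr
        linarith [hr.2]
      have e4 : (1 + κ⁻¹) * (σ r - σ s) ≤ (1 + κ⁻¹) * W := by
        gcongr
        linarith
      calc _ ≤ B * W + 2 * W + (1 + κ⁻¹) * W := by
            refine add_le_add (add_le_add e3 ?_) e4
            linarith
        _ = L * W := by rw [hL]; ring
    -- At `b` the two lengths may differ, as `arcVertex` is `v_K^-(b)` there; hence the open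
    -- interval.
    have hβt : ∀ r ∈ Ioo s t, tangentLength K z r = β r := by
      intro r hr
      simp only [tangentLength, hβ, hw, arcVertex_of_lt (hr.2.trans_le htb)]
    have bi := abs_integral_sub_le hst hlt1.le
      (intervalIntegrable_tangentLength_sq (K := K) hz.1 has hst htb) (hβB s hs) (hβB t ht)
      (fun r hr => by rw [hβt r hr]; exact hβB r ⟨has.trans hr.1.le, hr.2.le.trans htb⟩)
      (fun r hr => by rw [hβt r hr]; exact hdiff r (Ioo_subset_Icc_self hr))
      (hdiff t (right_mem_Icc.2 hst))
    have h0t : 0 ≤ t - s := sub_nonneg.2 hst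
    have hW0 : 0 ≤ W := by positivity
    have hΔR : σ t - σ s ≤ R := by
      have e1 := hσm (left_mem_Icc.2 hab.le) hs has
      have e2 := hσm ht (right_mem_Icc.2 hab.le) htb
      simp only [hR]
      linarith
    have hR0 : 0 ≤ R := hΔ.trans hΔR
    have hL0 : 0 ≤ L := by positivity
    have c1 : B * ((κ ^ 2)⁻¹ * (t - s) * (σ t - σ s)) ≤ (t - s) * (B * (κ ^ 2)⁻¹ * W) := by
      calc _ = (t - s) * (B * (κ ^ 2)⁻¹ * (σ t - σ s)) := by ring
        _ ≤ _ := by gcongr; linarith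
    have c2 : (κ ^ 2)⁻¹ * (t - s) * (σ t - σ s) * (σ t - σ s) ≤
        (t - s) * ((κ ^ 2)⁻¹ * R * W) := by
      calc _ ≤ (κ ^ 2)⁻¹ * (t - s) * R * W := by gcongr; linarith
        _ = _ := by ring
    have c3 : (t - s) * (B ^ 2 * (t - s) + 3 * B * (L * W)) ≤
        (t - s) * ((B ^ 2 + 3 * B * L) * W) := by
      calc _ ≤ (t - s) * (B ^ 2 * W + 3 * B * (L * W)) := by gcongr; linarith
        _ = _ := by ring
    have c4 : (t - s) * (C * W) ≤ ε * (C * W) := by gcongr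
    have c5 : (t - s) * (C * W) = (t - s) * (B * (κ ^ 2)⁻¹ * W) + (t - s) * ((κ ^ 2)⁻¹ * R * W) +
        (t - s) * ((B ^ 2 + 3 * B * L) * W) := by
      rw [hC]
      ring
    have c6 : 0 ≤ (t - s) * ((B ^ 2 + 3 * B * L) * W) := by positivity
    rw [abs_le] at bz bq ba bi ⊢
    simp only [zero_add]
    constructor <;> linarith [bz.1, bz.2, bq.1, bq.2, ba.1, ba.2, bi.1, bi.2]

/-! ### Minkowski combinations -/

theorem mem_bary {r : ℝ} {K L : Body} {p : Plane} : p ∈ (bary r K L : Set Plane) ↔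
    ∃ x ∈ (K : Set Plane), ∃ y ∈ (L : Set Plane), (1 - r) • x + r • y = p := by
  simp [bary, ConvexBody.coe_add, ConvexBody.coe_smul, mem_add, mem_smul_set]

theorem inner_comb (r : ℝ) (x y w : Plane) :
    (inner ℝ ((1 - r) • x + r • y) w : ℝ) = (1 - r) * inner ℝ x w + r * inner ℝ y w := by
  rw [inner_add_left, real_inner_smul_left, real_inner_smul_left]

theorem supp_bary {r : ℝ} (hr : r ∈ Icc (0 : ℝ) 1) (K L : Body) (t : ℝ) :
    supp (bary r K L) t = (1 - r) * supp K t + r * supp L t := by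
  have h0 : 0 ≤ 1 - r := sub_nonneg.2 hr.2
  apply le_antisymm
  · refine csSup_le ((bary r K L).nonempty.image _) ?_
    rintro _ ⟨p, hp, rfl⟩
    obtain ⟨x, hx, y, hy, rfl⟩ := mem_bary.1 hp
    simp only [inner_comb]
    exact add_le_add (mul_le_mul_of_nonneg_left (inner_le_supp K t hx) h0)
      (mul_le_mul_of_nonneg_left (inner_le_supp L t hy) hr.1)
  · obtain ⟨x, hx, hxs⟩ := edge_nonempty K t
    obtain ⟨y, hy, hys⟩ := edge_nonempty L t
    have hxs' : (inner ℝ x (u t) : ℝ) = supp K t := hxs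
    have hys' : (inner ℝ y (u t) : ℝ) = supp L t := hys
    rw [← hxs', ← hys', ← inner_comb]
    exact inner_le_supp _ t (mem_bary.2 ⟨x, hx, y, hy, rfl⟩)

theorem vPlus_bary {r : ℝ} (hr : r ∈ Icc (0 : ℝ) 1) (K L : Body) (t : ℝ) :
    vPlus (bary r K L) t = (1 - r) • vPlus K t + r • vPlus L t := by
  have h0 : 0 ≤ 1 - r := sub_nonneg.2 hr.2
  have hK : (inner ℝ (vPlus K t) (u t) : ℝ) = supp K t := (vPlus_mem_edge K t).2
  have hL : (inner ℝ (vPlus L t) (u t) : ℝ) = supp L t := (vPlus_mem_edge L t).2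
  have hB : (inner ℝ (vPlus (bary r K L) t) (u t) : ℝ) = supp (bary r K L) t :=
    (vPlus_mem_edge _ t).2
  have hu : (inner ℝ ((1 - r) • vPlus K t + r • vPlus L t) (u t) : ℝ) = supp (bary r K L) t := by
    rw [inner_comb, hK, hL, supp_bary hr]
  refine ext_inner_frame t (hB.trans hu.symm) (le_antisymm ?_ ?_)
  · obtain ⟨x, hx, y, hy, hxy⟩ := mem_bary.1 (vPlus_mem_edge (bary r K L) t).1
    have hx' := inner_le_supp K t hx
    have hy' := inner_le_supp L t hy
    rw [← hxy, inner_comb, supp_bary hr] at hB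
    rw [← hxy, inner_comb, inner_comb]
    -- a factor with positive weight attains its support value
    have key : ∀ (M : Body) (q : Plane) (c : ℝ), 0 ≤ c → q ∈ (M : Set Plane) →
        c * supp M t ≤ c * inner ℝ q (u t) →
        c * inner ℝ q (v t) ≤ c * inner ℝ (vPlus M t) (v t) := by
      intro M q c hc hq hle
      rcases hc.eq_or_lt with rfl | hc
      · simp
      · have he : q ∈ edge M t := ⟨hq, le_antisymm (inner_le_supp M t hq)
          (le_of_mul_le_mul_left hle hc)⟩
        exact mul_le_mul_of_nonneg_left (inner_le_vPlus M t he) hc.le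
    have e1 := mul_le_mul_of_nonneg_left hx' h0
    have e2 := mul_le_mul_of_nonneg_left hy' hr.1
    exact add_le_add (key K x (1 - r) h0 hx (by linarith)) (key L y r hr.1 hy (by linarith))
  · exact inner_le_vPlus _ t ⟨mem_bary.2 ⟨_, (vPlus_mem_edge K t).1, _, (vPlus_mem_edge L t).1, rfl⟩,
      hu⟩

section Family

variable {a b : ℝ} {z : Body → ℝ → Plane}

theorem tangentLength_bary (hz : IsConvexLinear fun K => (Icc a b).domRestrict (z K)) {r : ℝ}
    (hr : r ∈ Icc (0 : ℝ) 1) (K L : Body) {t : ℝ} (ht : t ∈ Icc a b) :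
    tangentLength (bary r K L) (z (bary r K L)) t =
      (1 - r) * tangentLength K (z K) t + r * tangentLength L (z L) t := by
  have h : z (bary r K L) t = (1 - r) • z K t + r • z L t := congrFun (hz r hr K L) ⟨t, ht⟩
  simp only [tangentLength, h, vPlus_bary hr, inner_sub_left, inner_comb]
  ring

/-- The polar form is `½ ∫ α_K α_L`; by symmetry linearity in one variable suffices. -/
theorem isQuadratic_integral (hab : a ≤ b) (hc : ∀ K, ContinuousOn (z K) (Icc a b))
    (hz : IsConvexLinear fun K => (Icc a b).domRestrict (z K)) :
    IsQuadratic fun K => (1 / 2) * ∫ t in a..b, tangentLength K (z K) t ^ 2 := by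
  have lin : ∀ K, IsConvexLinear fun L =>
      (1 / 2) * ∫ t in a..b, tangentLength K (z K) t * tangentLength L (z L) t := by
    intro K r hr L M
    have hi := fun L => intervalIntegrable_tangentLength_mul (K := K) (L := L) (hc K) (hc L) le_rfl
      hab le_rfl
    have : ∫ t in a..b, tangentLength K (z K) t * tangentLength (bary r L M) (z (bary r L M)) t =
        ∫ t in a..b, ((1 - r) * (tangentLength K (z K) t * tangentLength L (z L) t) +
          r * (tangentLength K (z K) t * tangentLength M (z M) t)) := by
      refine intervalIntegral.integral_congr fun t ht => ?_
      rw [uIcc_of_le hab] at ht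
      simp only [tangentLength_bary hz hr L M ht]
      ring
    simp only [this, smul_eq_mul]
    rw [intervalIntegral.integral_add ((hi L).const_mul _) ((hi M).const_mul _),
      intervalIntegral.integral_const_mul, intervalIntegral.integral_const_mul]
    ring
  refine ⟨fun K L => (1 / 2) * ∫ t in a..b, tangentLength K (z K) t * tangentLength L (z L) t,
    ⟨lin, fun L => ?_⟩, fun K => by simp only [sq]⟩
  simpa only [mul_comm (tangentLength L (z L) _)] using lin L

theorem isConvexFunctional_integral (hab : a ≤ b) (hc : ∀ K, ContinuousOn (z K) (Icc a b))
    (hz : IsConvexLinear fun K => (Icc a b).domRestrict (z K)) :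
    IsConvexFunctional fun K => (1 / 2) * ∫ t in a..b, tangentLength K (z K) t ^ 2 := by
  intro r hr K L
  have hi := fun K => intervalIntegrable_tangentLength_sq (K := K) (hc K) le_rfl hab le_rfl
  have hle : ∫ t in a..b, tangentLength (bary r K L) (z (bary r K L)) t ^ 2 ≤
      ∫ t in a..b, ((1 - r) * tangentLength K (z K) t ^ 2 + r * tangentLength L (z L) t ^ 2) := by
    refine intervalIntegral.integral_mono_on hab (hi _) (((hi K).const_mul _).add
      ((hi L).const_mul _)) fun t ht => ?_
    rw [tangentLength_bary hz hr K L ht]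
    -- The pointwise convexity gap is `r (1 - r) (α_K - α_L)²`.
    nlinarith [mul_nonneg (mul_nonneg hr.1 (sub_nonneg.2 hr.2))
      (sq_nonneg (tangentLength K (z K) t - tangentLength L (z L) t))]
  rw [intervalIntegral.integral_add ((hi K).const_mul _) ((hi L).const_mul _),
    intervalIntegral.integral_const_mul, intervalIntegral.integral_const_mul] at hle
  simp only
  linarith

end Family

end Mamikon

theorem mainTheorem11 (a b : ℝ) (hab : a < b) (hba : b < a + Real.pi) :
    -- the boundary segment is a rectifiable Jordan arc with a well-defined curve area
    (∀ K : Mamikon.Body,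
      Mamikon.IsRectifiableArc (Mamikon.convexCurve K a b)
        (Mamikon.vPlus K a) (Mamikon.vMinus K b) ∧
      ∀ (c d : ℝ) (x : ℝ → Mamikon.Plane),
        Mamikon.IsArcParam (Mamikon.convexCurve K a b)
          (Mamikon.vPlus K a) (Mamikon.vMinus K b) c d x →
        Mamikon.curveArea c d x =
          Mamikon.arcArea (Mamikon.convexCurve K a b)
            (Mamikon.vPlus K a) (Mamikon.vMinus K b)) ∧
    -- the generalized Mamikon theorem
    (∀ (K : Mamikon.Body) (z : ℝ → Mamikon.Plane),
      Mamikon.IsCBV a b z →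
      (∀ t ∈ Set.Icc a b, z t ∈ Mamikon.suppLine K t) →
      (∃ C : ℝ, ∀ t ∈ Set.Icc a b, |Mamikon.tangentLength K z t| ≤ C) ∧
      Measurable ((Set.Icc a b).domRestrict (Mamikon.tangentLength K z)) ∧
      (∀ t ∈ Set.Icc a b,
        z t = Mamikon.vPlus K t + Mamikon.tangentLength K z t • Mamikon.v t) ∧
      Mamikon.mamikonArea K a b z =
        (1 / 2) * ∫ t in a..b, Mamikon.tangentLength K z t ^ 2) ∧
    -- convexity and quadraticity for convex-linear families of curves
    (∀ z : Mamikon.Body → ℝ → Mamikon.Plane,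
      (∀ K, Mamikon.IsCBV a b (z K)) →
      (∀ K, ∀ t ∈ Set.Icc a b, z K t ∈ Mamikon.suppLine K t) →
      Mamikon.IsConvexLinear (fun K => (Set.Icc a b).domRestrict (z K)) →
      Mamikon.IsQuadratic (fun K => Mamikon.mamikonArea K a b (z K)) ∧
      Mamikon.IsConvexFunctional (fun K => Mamikon.mamikonArea K a b (z K))) := by
  have h := Mamikon.isChart_mid hab hba
  refine ⟨fun K => ?_, fun K z hz hzK => ⟨Mamikon.exists_tangentLength_bound K hz.1,
    Mamikon.measurable_domRestrict_tangentLength K hz.1,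
    fun t ht => Mamikon.eq_vPlus_add_tangentLength (hzK t ht), h.mamikonArea_eq hab K hz hzK⟩,
    fun z hz hzK hlin => ?_⟩
  · obtain ⟨x, hx, -⟩ := h.exists_isArcParam hab K
    exact ⟨⟨_, _, x, hx⟩, fun c d x hx => hx.curveArea_eq_arcArea⟩
  · have e : (fun K => Mamikon.mamikonArea K a b (z K)) =
        fun K => (1 / 2) * ∫ t in a..b, Mamikon.tangentLength K (z K) t ^ 2 :=
      funext fun K => h.mamikonArea_eq hab K (hz K) (hzK K)
    rw [e]
    exact ⟨Mamikon.isQuadratic_integral hab.le (fun K => (hz K).1) hlin,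
      Mamikon.isConvexFunctional_integral hab.le (fun K => (hz K).1) hlin⟩
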